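/- Let $\mathcal I$ be a collection of cardinals. A group is called $\mathcal I$-generated if it has a generating set $X$ with $|X|\le\lambda$ for some $\lambda\in\mathcal I$. Let $\Gamma$ be a non-empty finite graph without loops or multiple edges, with vertex set $V\Gamma$, let $\mathfrak G=\{G_v\mid v\in V\Gamma\}$ be a family of groups, and let $G=\Gamma\mathfrak G$ be their graph product, i.e. the quotient of the free product of the groups $G_v$ by the relations $[a,b]=1$ for all $a\in G_u$, $b\in G_v$ with $\{u,v\}$ an edge of $\Gamma$. Let $\mathbb F_2$ be the free group of rank $2$ and $\mathbb D_\infty$ the infinite dihedral group. Define classes of groups $\mathcal{IS}\mathfrak G_n$, $n=1,2,3,\dots$, as follows. - $\mathcal{IS}\mathfrak G_1$ is the class of all $\mathcal I$-generated groups that are isomorphic to a subgroup of $G_v$ for some $v\in V\Gamma$ and contain no copy of $\mathbb F_2$. - $\mathcal{IS}\mathfrak G_2$ is the smallest class of groups, closed under isomorphism, that contains every $\mathcal I$-generated subgroup of $A\times B$ for all $A,B\in\mathcal{IS}\mathfrak G_1$, contains $\mathbb Z$, and, if some $G_v$ has an element of order $2$, contains $\mathbb D_\infty$. - For $n\ge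 3$, $\mathcal{IS}\mathfrak G_n$ is the class of all $\mathcal I$-generated groups that are isomorphic to a subgroup of $A\times B$ for some $A\in\mathcal{IS}\mathfrak G_l$ and $B\in\mathcal{IS}\mathfrak G_m$ with integers $l,m\ge 1$, $l+m=n$. **Theorem.** If $H\leqslant G$ is an $\mathcal I$-generated subgroup which contains no copy of $\mathbb F_2$, then $H\in\mathcal{IS}\mathfrak G_{|V\Gamma|}$. -/

import Mathlib

universe u v w

/-- A group `H` is `I`-generated, for a collection `I` of cardinals, if it has a generating set
whose cardinality is at most some member of `I`. -/
def IsCardGenerated (I : Set Cardinal.{w}) (H : Type w) [Group H] : Prop :=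
  ∃ X : Set H, Subgroup.closure X = ⊤ ∧ ∃ κ ∈ I, Cardinal.mk X ≤ κ

/-- `H` contains a copy of the free group `F₂` of rank two. -/
def ContainsFreeGroupTwo (H : Type w) [Group H] : Prop :=
  ∃ f : FreeGroup (Fin 2) →* H, Function.Injective f

/-- The defining relators of the graph product: the commutators `a b a⁻¹ b⁻¹` with `a ∈ G_s`,
`b ∈ G_t` and `{s, t}` an edge of `Γ`, inside the free product of the vertex groups. -/
def graphProductRelators {V : Type u} (Γ : SimpleGraph V) (G : V → Type v) [∀ s, Group (G s)] :
    Set (Monoid.CoprodI G) :=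
  {x | ∃ (s t : V) (a : G s) (b : G t), Γ.Adj s t ∧
    x = Monoid.CoprodI.of a * Monoid.CoprodI.of b *
      (Monoid.CoprodI.of a)⁻¹ * (Monoid.CoprodI.of b)⁻¹}

/-- The graph product of the family of groups `G` over the simplicial graph `Γ`: the quotient of
the free product of the vertex groups by the relations saying that elements of adjacent vertex
groups commute. -/
abbrev GraphProduct {V : Type u} (Γ : SimpleGraph V) (G : V → Type v) [∀ s, Group (G s)] :
    Type (max u v) :=
  Monoid.CoprodI G ⧸ Subgroup.normalClosure (graphProductRelators Γ G)

/-- `ISG I G n H` says that the group `H` belongs to the `n`-th class attached to the collection of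
cardinals `I` and to the family of vertex groups `G`:

* the first class consists of the `I`-generated groups without a copy of `F₂` that are isomorphic
  to a subgroup of some `G s` (constructor `vertex`);
* the second class is the smallest isomorphism-closed class that contains all `I`-generated
  subgroups of `A × B` with `A`, `B` in the first class (constructor `prod` with `l = m = 1`), the
  infinite cyclic group (constructor `int`), and, if some `G s` has an element of order two, the
  infinite dihedral group, which is `DihedralGroup 0` (constructor `dihedral`);
* for `n ≥ 3` the `n`-th class consists of the `I`-generated groups isomorphic to a subgroup of
  some `A × B` with `A` in the `l`-th and `B` in the `m`-th class, `l, m ≥ 1`, `l + m = n`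
  (constructor `prod`).

"Isomorphic to a subgroup" is expressed by an injective homomorphism. -/
inductive ISG (I : Set Cardinal.{w}) {V : Type u} (G : V → Type v) [∀ s, Group (G s)] :
    ℕ → (H : Type w) → [Group H] → Prop
  | vertex {H : Type w} [Group H] (hgen : IsCardGenerated I H) (hfree : ¬ ContainsFreeGroupTwo H)
      (s : V) (f : H →* G s) (hf : Function.Injective f) : ISG I G 1 H
  | int {H : Type w} [Group H] (e : H ≃* Multiplicative ℤ) : ISG I G 2 H
  | dihedral {H : Type w} [Group H] (s : V) (g : G s) (hg : orderOf g = 2)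
      (e : H ≃* DihedralGroup 0) : ISG I G 2 H
  | prod {n l m : ℕ} (hl : 1 ≤ l) (hm : 1 ≤ m) (hn : l + m = n)
      {H A B : Type w} [Group H] [Group A] [Group B]
      (hA : ISG I G l A) (hB : ISG I G m B) (hgen : IsCardGenerated I H)
      (f : H →* A × B) (hf : Function.Injective f) : ISG I G n H

/-!
The proof is an induction on the number of vertices of a parabolic subgroup, the subgroup generated by
the vertex groups with index in a set of vertices; `GraphProduct.retract` retracts the graph product
onto it. Let `H` have no copy of `F₂` and embed in the parabolic subgroup of `T`, let `v ∈ T`,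
`T' = T \ {v}`, let `L` be the set of neighbours of `v` in `T'`, and let `A`, `Q` and `R ≤ Q` be the
parabolic subgroups of `{v}`, `T'` and `L`.

The parabolic subgroup of `T` is the amalgam of `A × R` and `Q` over `R`. It embeds in the semidirect
product of the free group on the set `A × Q / R` with `A × Q`, which permutes the letters: `Q` embeds
as a factor of `A × Q`, and `A` embeds as the conjugate of the other factor by the letter `(1, R)`,
which commutes with `R` (`GraphProduct.toFreePerm`, `GraphProduct.retract_insert_eq_one`). Hence the
kernel of `H → A × Q` is a subgroup of a free group. It is free by the Nielsen–Schreier theorem and has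
no copy of `F₂`, so that it is trivial or infinite cyclic.

If it is trivial, then `H` embeds in the product of its images in `A` and in `Q`, which belong to the
classes with numbers `1` and `|T| - 1`. The same holds if `v` is adjacent to every vertex in `T'`, the
parabolic subgroup of `T` being `A × Q`.

If it is generated by `a ≠ 1`, then `H` normalizes `⟨a⟩` and so preserves the axis of `a` in the Cayley
tree of the free group (`FreeGroup.exists_axis`). This gives a homomorphism `τ` from `H` to the infinite
dihedral group with infinite image (`FreePerm.exists_hom_dihedral`). An element of the kernel of `τ`
fixes a letter, so its image in `Q` is conjugate into `R`, by the same element of `Q` for all of them,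
and the kernel embeds in `R` under the retraction. Therefore `H` embeds in the product of its images
under `τ` and in `R`, which belong to the classes with numbers `2` and `|L| ≤ |T| - 2` if `v` is not
adjacent to all of `T'` (if `L` is empty, then `τ` is injective). An infinite subgroup of the infinite
dihedral group is `ℤ` or `D∞`. In the second case some element of `H` acts as a reflection, and its
image `p` in `A × Q` interchanges two different letters. Then `A` has an element of order two, or `p`
gives an element outside `R` whose square lies in `R`; the latter is impossible if no vertex group has
an element of order two, as parabolic subgroups are then closed under square roots
(`GraphProduct.retract_eq_of_mul_self`, proved by an induction with the same embedding).
-/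

/-! ### Words and lines in free groups -/

section Line

variable {E : Type*}

namespace FreeGroup

theorem norm_mk_of_isReduced [DecidableEq E] {L : List (E × Bool)} (h : IsReduced L) :
    norm (mk L) = L.length := by
  rw [norm, toWord_mk, h.reduce_eq]

theorem mk_singleton_inv (z : E × Bool) : (mk [z])⁻¹ = mk [(z.1, !z.2)] := by
  simp [inv_mk, invRev]

theorem IsReduced.map {F : Type*} {f : E → F} (hf : Function.Injective f)
    {L : List (E × Bool)} (h : IsReduced L) : IsReduced (L.map fun x => (f x.1, x.2)) := by
  rw [IsReduced, List.isChain_map]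
  exact List.IsChain.imp (fun a b hab e => hab (hf e)) h

theorem toWord_map [DecidableEq E] {F : Type*} [DecidableEq F] {f : E → F}
    (hf : Function.Injective f) (x : FreeGroup E) :
    (FreeGroup.map f x).toWord = x.toWord.map fun z => (f z.1, z.2) := by
  conv_lhs => rw [← mk_toWord (x := x), map.mk, toWord_mk,
    (isReduced_toWord.map hf).reduce_eq]

/-- A labelled line in the Cayley tree of a free group: the vertex `ℓ (n + 1)` is reached from
`ℓ n` along the edge labelled `y n`, and consecutive labels do not cancel. -/
structure IsLine (ℓ : ℤ → FreeGroup E) (y : ℤ → E × Bool) : Prop where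
  step : ∀ n, ℓ (n + 1) = ℓ n * mk [y n]
  reduced : ∀ n, (y n).1 = (y (n + 1)).1 → (y n).2 = (y (n + 1)).2

namespace IsLine

variable {ℓ : ℤ → FreeGroup E} {y : ℤ → E × Bool}

theorem eq_mul_mk (h : IsLine ℓ y) (m : ℤ) (d : ℕ) :
    ℓ (m + d) = ℓ m * FreeGroup.mk ((List.range d).map fun i : ℕ => y (m + i)) := by
  induction d with
  | zero => simp [← one_eq_mk]
  | succ d ih =>
    rw [List.range_succ, List.map_append, ← mul_mk, ← mul_assoc, ← ih]
    have := h.step (m + d)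
    rw [add_assoc] at this
    simpa using this

theorem isReduced (h : IsLine ℓ y) (m : ℤ) (d : ℕ) :
    FreeGroup.IsReduced ((List.range d).map fun i : ℕ => y (m + i)) := by
  rw [FreeGroup.IsReduced, List.isChain_map]
  rcases d with _ | d
  · simp
  · rw [List.isChain_range_succ]
    intro i _ e
    have := h.reduced (m + i)
    push_cast at e ⊢
    rw [← add_assoc] at e ⊢
    exact this e

theorem norm_eq [DecidableEq E] (h : IsLine ℓ y) (m n : ℤ) :
    norm ((ℓ m)⁻¹ * ℓ n) = (m - n).natAbs := by
  have key : ∀ (m : ℤ) (d : ℕ), norm ((ℓ m)⁻¹ * ℓ (m + d)) = d := by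
    intro m d
    rw [h.eq_mul_mk, inv_mul_cancel_left, norm_mk_of_isReduced (h.isReduced m d)]
    simp
  rcases le_total m n with hmn | hmn
  · obtain ⟨d, rfl⟩ := Int.le.dest hmn
    rw [key]; omega
  · obtain ⟨d, rfl⟩ := Int.le.dest hmn
    rw [← norm_inv_eq, mul_inv_rev, inv_inv, key]; omega

theorem injective (h : IsLine ℓ y) : Function.Injective ℓ := by
  classical
  intro m n e
  have := h.norm_eq m n
  rw [e, inv_mul_cancel, FreeGroup.norm_one] at this
  omega

theorem mul_left (h : IsLine ℓ y) (u : FreeGroup E) : IsLine (fun n => u * ℓ n) y :=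
  ⟨fun n => by simp only [h.step, mul_assoc], h.reduced⟩

/-- Displacement formula: if `a` translates the line by `k`, then `a` moves a vertex at distance `d`
from the line by `k + 2 d`, since the path to the line, the segment of length `k` on the line and the
path back form a geodesic. -/
theorem norm_conj [DecidableEq E] (h : IsLine ℓ y) {k : ℕ} (hk : 0 < k)
    (hy : ∀ n, y (n + k) = y n) {a : FreeGroup E} (ha : ∀ n, a * ℓ n = ℓ (n + k))
    (u : FreeGroup E) :
    ∃ n, norm (u⁻¹ * a * u) = k + 2 * norm ((ℓ n)⁻¹ * u) := by
  -- The vertex of the line closest to `u`.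
  obtain ⟨n, hn⟩ : ∃ n, ∀ m, norm ((ℓ n)⁻¹ * u) ≤ norm ((ℓ m)⁻¹ * u) :=
    ⟨Function.argmin (fun n => norm ((ℓ n)⁻¹ * u)), fun m =>
      Function.argmin_le (fun n => norm ((ℓ n)⁻¹ * u)) m⟩
  refine ⟨n, ?_⟩
  set w := (ℓ n)⁻¹ * u with hw
  have hu : u = ℓ n * w := by simp [hw]
  have e1 : u⁻¹ * a * u = w⁻¹ * FreeGroup.mk ((List.range k).map fun i : ℕ => y (n + i)) * w := by
    have := h.eq_mul_mk n k
    rw [← ha n] at this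
    rw [hu, mul_inv_rev]
    have h2 : (ℓ n)⁻¹ * (a * ℓ n) = FreeGroup.mk ((List.range k).map fun i : ℕ => y (n + i)) := by
      rw [this, inv_mul_cancel_left]
    rw [← h2]; group
  -- The first letter of `w` does not run along the line, for `ℓ (n + 1)` and `ℓ (n - 1)` are not closer
  -- to `u` than `ℓ n`.
  have first : ∀ z ∈ w.toWord.head?, z ≠ y n ∧ (z.1, !z.2) ≠ y (n - 1) := by
    intro z hz
    obtain ⟨t, ht⟩ : ∃ t, w.toWord = z :: t := by
      rcases hwd : w.toWord with _ | ⟨z', t⟩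
      · simp [hwd] at hz
      · simp [hwd] at hz; exact ⟨t, by rw [hz]⟩
    have hwt : w = FreeGroup.mk [z] * FreeGroup.mk t := by
      rw [mul_mk, List.singleton_append, ← ht, mk_toWord]
    have hnw : norm w = t.length + 1 := by simp [norm, ht]
    constructor
    · rintro rfl
      have h1 := hn (n + 1)
      rw [h.step, mul_inv_rev, mul_assoc, ← hw, hwt, inv_mul_cancel_left, ← hwt, hnw] at h1
      have := norm_mk_le (L₁ := t)
      omega
    · intro e
      have h1 := hn (n - 1)
      have h2 := h.step (n - 1)
      rw [sub_add_cancel, ← e, ← mk_singleton_inv] at h2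
      have h3 : (ℓ (n - 1))⁻¹ * u = FreeGroup.mk t := by
        have : w = FreeGroup.mk [z] * ((ℓ (n - 1))⁻¹ * u) := by rw [hw, h2]; group
        rw [hwt] at this
        exact (mul_left_cancel this).symm
      rw [h3, hnw] at h1
      have := norm_mk_le (L₁ := t)
      omega
  have red : FreeGroup.IsReduced
      (invRev w.toWord ++ (List.range k).map (fun i : ℕ => y (n + i)) ++ w.toWord) := by
    obtain ⟨k, rfl⟩ : ∃ k', k = k' + 1 := ⟨k - 1, by omega⟩
    rw [FreeGroup.IsReduced, List.isChain_append, List.isChain_append]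
    refine ⟨⟨?_, h.isReduced n _, ?_⟩, isReduced_toWord, ?_⟩
    · have := isReduced_toWord (x := w⁻¹)
      rwa [toWord_inv] at this
    · intro x hx b hb e
      rw [invRev, List.getLast?_reverse, List.head?_map] at hx
      rw [List.head?_map, List.head?_range] at hb
      simp only [Option.mem_def, Option.map_eq_some_iff] at hx
      simp at hb
      obtain ⟨z, hz, rfl⟩ := hx
      subst hb
      by_contra hne
      exact (first z hz).1 (Prod.ext e (by simpa using hne))
    · intro x hx b hb e
      rw [List.range_succ, List.map_append] at hx
      simp at hx
      subst hx
      by_contra hne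
      refine (first _ hb).2 ?_
      have := hy (n - 1)
      rw [show n - 1 + ((k + 1 : ℕ) : ℤ) = n + k by push_cast; ring] at this
      rw [← this]
      refine Prod.ext e.symm ?_
      change (!b.2) = _
      revert hne
      cases b.2 <;> cases (y (n + k)).2 <;> simp
  rw [e1]
  conv_lhs => rw [← mk_toWord (x := w), inv_mk, mul_mk, mul_mk, norm_mk_of_isReduced red]
  simp [norm, invRev_length]
  ring

end IsLine

/-- Every nontrivial element of a free group translates a line of its Cayley tree, its axis: the
periodic line labelled by its cyclic reduction. -/
theorem exists_axis {a : FreeGroup E} (ha : a ≠ 1) :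
    ∃ (ℓ : ℤ → FreeGroup E) (y : ℤ → E × Bool) (k : ℕ), 0 < k ∧ IsLine ℓ y ∧
      (∀ n, y (n + k) = y n) ∧ ∀ n, a * ℓ n = ℓ (n + k) := by
  classical
  set c : List (E × Bool) := reduceCyclically a.toWord with hc
  set u := mk (reduceCyclically.conjugator a.toWord)
  have hac : a = u * mk c * u⁻¹ := by
    conv_lhs => rw [← mk_toWord (x := a),
      ← reduceCyclically.conj_conjugator_reduceCyclically a.toWord, ← mul_mk, ← mul_mk, ← inv_mk]
  have hcyc : IsCyclicallyReduced c := reduceCyclically.isCyclicallyReduced isReduced_toWord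
  have hk : 0 < c.length := by
    rw [List.length_pos_iff]
    rintro h0
    apply ha
    rw [hac, h0]
    simp [← one_eq_mk]
  set k := c.length
  have hk' : (0 : ℤ) < k := by exact_mod_cast hk
  have hmod : ∀ n : ℤ, (n % k).toNat < k := fun n => by
    have := Int.emod_lt_of_pos n hk'
    omega
  have hnn : ∀ n : ℤ, 0 ≤ n % k := fun n => Int.emod_nonneg n hk'.ne'
  -- A step either stays inside a period or passes to the beginning of the next one.
  have succ_cases : ∀ n : ℤ,
      ((n + 1) / k = n / k ∧ ((n + 1) % k).toNat = (n % k).toNat + 1) ∨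
      ((n + 1) / k = n / k + 1 ∧ ((n + 1) % k).toNat = 0 ∧ (n % k).toNat + 1 = k) := by
    intro n
    have h0 := hnn n
    have h1 := Int.emod_lt_of_pos n hk'
    have h2 := Int.mul_ediv_add_emod n k
    rcases lt_or_eq_of_le (show n % k + 1 ≤ k by omega) with h | h
    · left
      have : (n + 1) / k = n / k ∧ (n + 1) % k = n % k + 1 :=
        (Int.ediv_emod_unique hk').2 ⟨by linarith, by omega, by omega⟩
      exact ⟨this.1, by omega⟩
    · right
      have : (n + 1) / k = n / k + 1 ∧ (n + 1) % k = 0 :=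
        (Int.ediv_emod_unique hk').2 ⟨by rw [mul_add]; linarith, by omega, by omega⟩
      exact ⟨this.1, by omega, by omega⟩
  have line : IsLine (fun n : ℤ => mk c ^ (n / (k : ℤ)) * mk (c.take (n % k).toNat))
      (fun n : ℤ => c.get ⟨(n % k).toNat, hmod n⟩) := by
    constructor
    · intro n
      have htake : mk (c.take (n % k).toNat) * mk [c.get ⟨(n % k).toNat, hmod n⟩]
          = mk (c.take ((n % k).toNat + 1)) := by
        rw [mul_mk, List.take_add_one, List.getElem?_eq_getElem (hmod n)]
        rfl
      rcases succ_cases n with ⟨h1, h2⟩ | ⟨h1, h2, h3⟩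
      · rw [h1, h2, mul_assoc, htake]
      · rw [h1, h2, mul_assoc, htake, h3, List.take_length, zpow_add_one]
        simp [← one_eq_mk]
    · intro n
      rcases succ_cases n with ⟨_, h2⟩ | ⟨_, h2, h3⟩
      · have := List.isChain_iff_getElem.1 hcyc.1 (n % k).toNat (by have := hmod (n + 1); omega)
        simpa only [h2, List.get_eq_getElem] using this
      · have := hcyc.2 (c.get ⟨(n % k).toNat, hmod n⟩) ?_ (c.get ⟨0, hk⟩) ?_
        · simpa only [h2] using this
        · rw [List.getLast?_eq_getElem?, Option.mem_def, List.getElem?_eq_some_iff]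
          exact ⟨by omega, by congr 1; omega⟩
        · rw [List.head?_eq_getElem?, Option.mem_def, List.getElem?_eq_some_iff]
          exact ⟨hk, rfl⟩
  refine ⟨_, _, k, hk, line.mul_left u, fun n => ?_, fun n => ?_⟩
  · simp
  · rw [hac]
    simp only [Int.add_emod_right]
    rw [Int.add_ediv_of_dvd_right (dvd_refl _), Int.ediv_self hk'.ne', add_comm, zpow_add, zpow_one]
    group

end FreeGroup

end Line

/-! ### Isometries of the integers and the infinite dihedral group -/

section Dihedral

open DihedralGroup

namespace DihedralGroup

/-- The translation by `i` in the infinite dihedral group. -/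
def rot (i : ℤ) : DihedralGroup 0 := r (Int.cast i)

/-- The reflection of the infinite dihedral group that acts on `ℤ` by `n ↦ -(n + i)`. -/
def mirror (i : ℤ) : DihedralGroup 0 := sr (Int.cast i)

theorem rot_mul_rot (i j : ℤ) : rot i * rot j = rot (i + j) := by
  simp only [rot, r_mul_r, Int.cast_add]

theorem rot_mul_mirror (i j : ℤ) : rot i * mirror j = mirror (j - i) := by
  simp only [rot, mirror, r_mul_sr, Int.cast_sub]

theorem mirror_mul_rot (i j : ℤ) : mirror i * rot j = mirror (i + j) := by
  simp only [rot, mirror, sr_mul_r, Int.cast_add]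

theorem mirror_mul_mirror (i j : ℤ) : mirror i * mirror j = rot (j - i) := by
  simp only [rot, mirror, sr_mul_sr, Int.cast_sub]

theorem rot_zero : rot 0 = 1 := by
  simp only [rot, Int.cast_zero, r_zero]

theorem inv_rot (i : ℤ) : (rot i)⁻¹ = rot (-i) := by
  rw [inv_eq_iff_mul_eq_one, rot_mul_rot, add_neg_cancel, rot_zero]

theorem rot_injective : Function.Injective rot := fun i j h => by
  have : (Int.cast i : ZMod 0) = Int.cast j := r.inj h
  exact Int.cast_injective this

theorem rot_ne_mirror (i j : ℤ) : rot i ≠ mirror j := fun h => by cases h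

theorem zero_cases (d : DihedralGroup 0) : (∃ i, d = rot i) ∨ ∃ i, d = mirror i := by
  rcases d with i | i
  · obtain ⟨i, rfl⟩ := ZMod.intCast_surjective i; exact Or.inl ⟨i, rfl⟩
  · obtain ⟨i, rfl⟩ := ZMod.intCast_surjective i; exact Or.inr ⟨i, rfl⟩

/-- The action of the infinite dihedral group on `ℤ`: `rot i` is the translation by `i`, and
`mirror i` is the reflection `n ↦ -(n + i)`. -/
def onInt : DihedralGroup 0 → ℤ → ℤ
  | r i => fun n => n + ZMod.cast i
  | sr i => fun n => -(n + ZMod.cast i)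

theorem onInt_rot (i n : ℤ) : onInt (rot i) n = n + i := rfl

theorem onInt_mirror (i n : ℤ) : onInt (mirror i) n = -(n + i) := rfl

theorem onInt_mul (d d' : DihedralGroup 0) (n : ℤ) :
    onInt (d * d') n = onInt d (onInt d' n) := by
  rcases d.zero_cases with ⟨i, rfl⟩ | ⟨i, rfl⟩ <;> rcases d'.zero_cases with ⟨j, rfl⟩ | ⟨j, rfl⟩
  · rw [rot_mul_rot, onInt_rot, onInt_rot, onInt_rot]; ring
  · rw [rot_mul_mirror, onInt_mirror, onInt_rot, onInt_mirror]; ring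
  · rw [mirror_mul_rot, onInt_mirror, onInt_rot, onInt_mirror]; ring
  · rw [mirror_mul_mirror, onInt_mirror, onInt_rot, onInt_mirror]; ring

theorem onInt_injective : Function.Injective onInt := by
  intro d d' h
  have h0 := congrFun h 0
  have h1 := congrFun h 1
  rcases d.zero_cases with ⟨i, rfl⟩ | ⟨i, rfl⟩ <;>
    rcases d'.zero_cases with ⟨j, rfl⟩ | ⟨j, rfl⟩ <;>
    simp only [onInt_rot, onInt_mirror] at h0 h1
  · rw [show i = j by omega]
  · omega
  · omega
  · rw [show i = j by omega]

end DihedralGroup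

theorem Int.isometry_cases {σ : ℤ → ℤ} (h : ∀ m n, (σ m - σ n).natAbs = (m - n).natAbs) :
    (∀ n, σ n = n + σ 0) ∨ ∀ n, σ n = -(n + -σ 0) := by
  have h10 := h 1 0
  rcases (show σ 1 = σ 0 + 1 ∨ σ 1 = σ 0 - 1 by omega) with h1 | h1
  · left; intro n
    have h2 := h n 0
    have h3 := h n 1
    omega
  · right; intro n
    have h2 := h n 0
    have h3 := h n 1
    omega

/-- An isometric action on `ℤ` is a homomorphism to the infinite dihedral group. -/
theorem exists_hom_dihedral {H : Type*} [Group H] (σ : H → ℤ → ℤ)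
    (hmul : ∀ g h n, σ (g * h) n = σ g (σ h n))
    (hiso : ∀ h m n, (σ h m - σ h n).natAbs = (m - n).natAbs) :
    ∃ τ : H →* DihedralGroup 0, ∀ h, onInt (τ h) = σ h := by
  have ex : ∀ h, ∃ d : DihedralGroup 0, onInt d = σ h := fun h => by
    rcases Int.isometry_cases (hiso h) with hc | hc
    · exact ⟨rot (σ h 0), funext fun n => by rw [onInt_rot, hc n]⟩
    · exact ⟨mirror (-σ h 0), funext fun n => by rw [onInt_mirror, hc n]⟩
  choose τ hτ using ex
  refine ⟨MonoidHom.mk' τ fun g h => onInt_injective (funext fun n => ?_), hτ⟩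
  rw [onInt_mul, hτ, hτ, hτ, hmul]

/-- An infinite subgroup of the infinite dihedral group is infinite cyclic or infinite dihedral; in
the second case it contains a reflection. -/
theorem mulEquiv_of_injective_dihedral {K : Type*} [Group K] (τ : K →* DihedralGroup 0)
    (hτ : Function.Injective τ) (hr : ∃ h i, i ≠ 0 ∧ τ h = rot i) :
    Nonempty (K ≃* Multiplicative ℤ) ∨
      (Nonempty (K ≃* DihedralGroup 0) ∧ ∃ h i, τ h = mirror i) := by
  -- The translations in the image form a subgroup `d ℤ` of `ℤ`.
  let R : AddSubgroup ℤ :=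
    { carrier := {i : ℤ | ∃ h, τ h = rot i}
      add_mem' := by
        rintro i j ⟨g, hg⟩ ⟨h, hh⟩
        exact ⟨g * h, by rw [map_mul, hg, hh, rot_mul_rot]⟩
      zero_mem' := ⟨1, by rw [map_one, rot_zero]⟩
      neg_mem' := by
        rintro i ⟨g, hg⟩
        exact ⟨g⁻¹, by rw [map_inv, hg, inv_rot]⟩ }
  obtain ⟨d, hd⟩ := Int.subgroup_cyclic R
  have hmem : ∀ i : ℤ, (∃ h, τ h = rot i) ↔ ∃ m : ℤ, m * d = i := fun i => by
    change i ∈ R ↔ _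
    rw [hd, AddSubgroup.mem_closure_singleton]
    simp
  have hd0 : d ≠ 0 := by
    obtain ⟨h, i, hi, hh⟩ := hr
    obtain ⟨m, rfl⟩ := (hmem i).1 ⟨h, hh⟩
    rintro rfl
    simp at hi
  have of_range : ∀ {M : Type} [Group M] (ψ : M →* DihedralGroup 0), Function.Injective ψ →
      τ.range = ψ.range → Nonempty (K ≃* M) := fun ψ hψ hrange =>
    ⟨(MonoidHom.ofInjective hτ).trans
      ((MulEquiv.subgroupCongr hrange).trans (MonoidHom.ofInjective hψ).symm)⟩
  by_cases hmir : ∃ h i, τ h = mirror i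
  · right
    refine ⟨?_, hmir⟩
    obtain ⟨s, c, hs⟩ := hmir
    let ψ : DihedralGroup 0 →* DihedralGroup 0 := MonoidHom.mk'
      (fun x => match x with
        | r i => r (i * Int.cast d)
        | sr i => sr (Int.cast c + i * Int.cast d)) (by
        rintro (i | i) (j | j)
        · rw [r_mul_r]; exact (congrArg r (by ring)).trans (r_mul_r _ _).symm
        · rw [r_mul_sr]; exact (congrArg sr (by ring)).trans (r_mul_sr _ _).symm
        · rw [sr_mul_r]; exact (congrArg sr (by ring)).trans (sr_mul_r _ _).symm
        · rw [sr_mul_sr]; exact (congrArg r (by ring)).trans (sr_mul_sr _ _).symm)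
    have ψr : ∀ i, ψ (rot i) = rot (i * d) := fun i =>
      congrArg r (Int.cast_mul (α := ZMod 0) i d).symm
    have ψs : ∀ i, ψ (mirror i) = mirror (c + i * d) := fun i =>
      congrArg sr (by rw [Int.cast_add, Int.cast_mul])
    have hψ : Function.Injective ψ := by
      rw [injective_iff_map_eq_one]
      intro x h
      rcases x.zero_cases with ⟨i, rfl⟩ | ⟨i, rfl⟩
      · rw [ψr, ← rot_zero] at h
        rw [(mul_eq_zero.1 (rot_injective h)).resolve_right hd0, rot_zero]
      · rw [ψs, ← rot_zero] at h
        exact absurd h.symm (rot_ne_mirror _ _)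
    refine of_range ψ hψ (le_antisymm ?_ ?_)
    · rintro _ ⟨h, rfl⟩
      rcases (τ h).zero_cases with ⟨i, hh⟩ | ⟨i, hh⟩
      · obtain ⟨m, hm⟩ := (hmem i).1 ⟨h, hh⟩
        exact ⟨rot m, by rw [hh, ← hm, ψr]⟩
      · obtain ⟨m, hm⟩ := (hmem (i - c)).1 ⟨s * h, by rw [map_mul, hs, hh, mirror_mul_mirror]⟩
        exact ⟨mirror m, by rw [hh, ψs, hm, add_sub_cancel]⟩
    · rintro _ ⟨x, rfl⟩
      rcases x.zero_cases with ⟨i, rfl⟩ | ⟨i, rfl⟩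
      · obtain ⟨h, hh⟩ := (hmem (i * d)).2 ⟨i, rfl⟩
        exact ⟨h, by rw [hh, ψr]⟩
      · obtain ⟨h, hh⟩ := (hmem (i * d)).2 ⟨i, rfl⟩
        exact ⟨s * h, by rw [map_mul, hs, hh, mirror_mul_rot, ψs]⟩
  · left
    push Not at hmir
    have hall : ∀ h, ∃ m : ℤ, τ h = rot (m * d) := fun h => by
      rcases (τ h).zero_cases with ⟨i, hh⟩ | ⟨i, hh⟩
      · obtain ⟨m, hm⟩ := (hmem i).1 ⟨h, hh⟩
        exact ⟨m, by rw [hh, ← hm]⟩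
      · exact absurd hh (hmir h i)
    let ψ : Multiplicative ℤ →* DihedralGroup 0 := MonoidHom.mk'
      (fun m => rot (m.toAdd * d)) (fun a b => by rw [rot_mul_rot, toAdd_mul, add_mul])
    have hψ : Function.Injective ψ := fun a b h =>
      Multiplicative.toAdd.injective (mul_right_cancel₀ hd0 (rot_injective h))
    refine of_range ψ hψ (le_antisymm ?_ ?_)
    · rintro _ ⟨h, rfl⟩
      obtain ⟨m, hm⟩ := hall h
      exact ⟨Multiplicative.ofAdd m, hm.symm⟩
    · rintro _ ⟨m, rfl⟩
      exact (hmem (m.toAdd * d)).2 ⟨m.toAdd, rfl⟩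

end Dihedral

/-! ### Semidirect products of free groups with groups permuting the letters -/

section FreePerm

open DihedralGroup

variable (P E : Type*) [Group P] [MulAction P E]

/-- The action of `P` on the free group on a `P`-set `E` that permutes the letters. -/
def freePerm : P →* MulAut (FreeGroup E) :=
  MonoidHom.mk' (fun p => FreeGroup.freeGroupCongr (MulAction.toPerm p)) fun p q => by
    ext x
    change FreeGroup.map _ x = FreeGroup.map _ (FreeGroup.map _ x)
    rw [FreeGroup.map.comp]
    congr 2
    funext e
    exact mul_smul p q e

/-- The semidirect product `FreeGroup E ⋊ P` in which `P` permutes the letters. -/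
abbrev FreePerm := FreeGroup E ⋊[freePerm P E] P

variable {P E}

theorem freePerm_apply (p : P) (x : FreeGroup E) :
    freePerm P E p x = FreeGroup.map (p • ·) x := rfl

theorem freePerm_of (p : P) (e : E) :
    freePerm P E p (FreeGroup.of e) = FreeGroup.of (p • e) := FreeGroup.map.of

theorem freePerm_letter (p : P) (z : E × Bool) :
    freePerm P E p (FreeGroup.mk [z]) = FreeGroup.mk [(p • z.1, z.2)] := by
  rw [freePerm_apply, FreeGroup.map.mk, List.map_singleton]

theorem toWord_freePerm [DecidableEq E] (p : P) (x : FreeGroup E) :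
    (freePerm P E p x).toWord = x.toWord.map fun z => (p • z.1, z.2) := by
  rw [freePerm_apply, FreeGroup.toWord_map (MulAction.injective p)]

theorem norm_freePerm [DecidableEq E] (p : P) (x : FreeGroup E) :
    (freePerm P E p x).norm = x.norm := by
  rw [FreeGroup.norm, toWord_freePerm, List.length_map, FreeGroup.norm]

/-- If `w = (f, p)` and `w ^ 2 ∈ P`, then either `w ∈ P` or `p` interchanges two different letters:
`w` reverses the geodesic from `1` to `f` in the Cayley tree, and as the letters keep their signs
this geodesic has a middle vertex, at which `w` interchanges two edges. -/
theorem FreePerm.left_eq_one_or_swap (w : FreePerm P E)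
    (hw : w.left * freePerm P E w.right w.left = 1) :
    w.left = 1 ∨ ∃ e : E, w.right • e ≠ e ∧ w.right • w.right • e = e := by
  classical
  by_cases h1 : w.left = 1
  · exact Or.inl h1
  right
  set L := w.left.toWord with hL
  have hpos : 0 < L.length := by
    rw [List.length_pos_iff]
    exact fun h => h1 (FreeGroup.toWord_eq_nil_iff.1 h)
  have hrev : L.map (fun z => (w.right • z.1, z.2)) = FreeGroup.invRev L := by
    rw [hL, ← toWord_freePerm, ← FreeGroup.toWord_inv, eq_inv_of_mul_eq_one_right hw]
  -- Comparison of the letters of the two words at the position `i`.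
  have hget : ∀ i (hi : i < L.length), (w.right • L[i].1, L[i].2) =
      ((L[L.length - 1 - i]).1, !(L[L.length - 1 - i]).2) := by
    intro i hi
    have h2 := congrArg (fun l => l[i]?) hrev
    simp only [FreeGroup.invRev, List.getElem?_map, List.getElem?_eq_getElem hi,
      List.getElem?_reverse (show i < (L.map _).length by simpa using hi),
      List.length_map, Option.map_some] at h2
    rw [List.getElem?_eq_getElem (by omega)] at h2
    simpa using h2
  rcases Nat.even_or_odd' L.length with ⟨m, hm | hm⟩
  · have ha := hget (m - 1) (by omega)
    have hb := hget m (by omega)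
    have hi : L.length - 1 - (m - 1) = m := by omega
    have hj : L.length - 1 - m = m - 1 := by omega
    simp only [hi] at ha
    simp only [hj] at hb
    obtain ⟨ha1, ha2⟩ := Prod.mk.inj ha
    obtain ⟨hb1, -⟩ := Prod.mk.inj hb
    refine ⟨L[m - 1].1, fun he => ?_, by rw [ha1, hb1]⟩
    have red := List.isChain_iff_getElem.1 (FreeGroup.isReduced_toWord (x := w.left)) (m - 1)
      (by change m - 1 + 1 < L.length; omega)
    have hs : m - 1 + 1 = m := by omega
    simp only [← hL, hs] at red
    have := red (by rw [← he, ha1])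
    rw [this] at ha2
    simp at ha2
  · have ha := hget m (by omega)
    have hi : L.length - 1 - m = m := by omega
    simp only [hi] at ha
    have := (Prod.mk.inj ha).2
    simp at this

/-- The action of `FreeGroup E ⋊ P` on the vertices of the Cayley tree of `FreeGroup E`. -/
def FreePerm.act (w : FreePerm P E) (u : FreeGroup E) : FreeGroup E :=
  w.left * freePerm P E w.right u

theorem FreePerm.act_mul (w w' : FreePerm P E) (u : FreeGroup E) :
    (w * w').act u = w.act (w'.act u) := by
  simp only [FreePerm.act, SemidirectProduct.mul_left, SemidirectProduct.mul_right, map_mul,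
    MulAut.mul_apply, mul_assoc]

theorem FreePerm.act_inl (a u : FreeGroup E) :
    FreePerm.act (SemidirectProduct.inl a : FreePerm P E) u = a * u := by
  simp [FreePerm.act]

theorem FreePerm.act_inr (p : P) (u : FreeGroup E) :
    FreePerm.act (SemidirectProduct.inr p : FreePerm P E) u = freePerm P E p u := by
  simp [FreePerm.act]

instance FreePerm.instMulAction : MulAction (FreePerm P E) (FreeGroup E) where
  smul := FreePerm.act
  one_smul u := by
    change FreePerm.act 1 u = u
    simp [FreePerm.act]
  mul_smul := FreePerm.act_mul

theorem FreePerm.smul_eq_act (w : FreePerm P E) (u : FreeGroup E) : w • u = w.act u := rfl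

theorem FreePerm.inv_act_mul_act (w : FreePerm P E) (u v : FreeGroup E) :
    (w.act u)⁻¹ * w.act v = freePerm P E w.right (u⁻¹ * v) := by
  simp only [FreePerm.act, map_mul, map_inv]
  group

theorem FreePerm.act_mul_right (w : FreePerm P E) (u v : FreeGroup E) :
    w.act (u * v) = w.act u * freePerm P E w.right v := by
  simp only [FreePerm.act, map_mul, mul_assoc]

/-- A group that normalizes the cyclic group generated by a nontrivial element `a` of the free group
preserves the axis of `a`, hence maps to the infinite dihedral group. The kernel fixes a letter, as it
fixes an edge of the axis, and an element acting as a reflection interchanges two different letters, as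
it interchanges two edges of the axis at a vertex. -/
theorem FreePerm.exists_hom_dihedral {H : Type*} [Group H] (j : H →* FreePerm P E)
    {a : FreeGroup E} (ha : a ≠ 1) {h₀ : H} (h₀a : j h₀ = SemidirectProduct.inl a)
    (hnorm : ∀ h, SemidirectProduct.inl a * j h = j h * SemidirectProduct.inl a ∨
      SemidirectProduct.inl a * j h = j h * SemidirectProduct.inl a⁻¹) :
    ∃ (τ : H →* DihedralGroup 0) (e : E),
      (∃ i, i ≠ 0 ∧ τ h₀ = rot i) ∧
      (∀ h, τ h = 1 → (j h).right • e = e ∧ ((j h).right = 1 → j h = 1)) ∧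
      ∀ h i, τ h = mirror i →
        ∃ e' : E, (j h).right • e' ≠ e' ∧ (j h).right • (j h).right • e' = e' := by
  classical
  obtain ⟨ℓ, y, k, hk, line, hy, hℓ⟩ := FreeGroup.exists_axis ha
  -- The axis consists of the vertices that `a` moves by `k`, the least possible distance. Elements that
  -- conjugate `a` to `a` or `a⁻¹` preserve this set.
  have on_axis : ∀ n, ((ℓ n)⁻¹ * a * ℓ n).norm = k := fun n => by
    rw [mul_assoc, hℓ, line.norm_eq]; omega
  have axis : ∀ u : FreeGroup E, (u⁻¹ * a * u).norm = k → ∃ n, u = ℓ n := fun u hu => by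
    obtain ⟨n, hn⟩ := line.norm_conj hk hy hℓ u
    refine ⟨n, ?_⟩
    have h0 : ((ℓ n)⁻¹ * u).norm = 0 := by omega
    rw [FreeGroup.norm_eq_zero] at h0
    exact (inv_mul_eq_one.1 h0).symm
  have disp : ∀ h u, (((j h).act u)⁻¹ * a * (j h).act u).norm = (u⁻¹ * a * u).norm := by
    intro h u
    rw [mul_assoc, ← FreePerm.act_inl (P := P) a, ← FreePerm.act_mul]
    rcases hnorm h with hh | hh
    · rw [hh, FreePerm.act_mul, FreePerm.inv_act_mul_act, norm_freePerm, FreePerm.act_inl,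
        mul_assoc]
    · rw [hh, FreePerm.act_mul, FreePerm.inv_act_mul_act, norm_freePerm, FreePerm.act_inl,
        ← FreeGroup.norm_inv_eq]
      congr 1
      group
  have ex : ∀ h n, ∃ m, (j h).act (ℓ n) = ℓ m := fun h n =>
    axis _ (by rw [disp, on_axis])
  choose σ hσ using ex
  obtain ⟨τ, hτ⟩ := _root_.exists_hom_dihedral σ
    (fun g h n => line.injective (by rw [← hσ, map_mul, FreePerm.act_mul, hσ, hσ]))
    (fun h m n => by
      rw [← line.norm_eq, ← line.norm_eq, ← hσ, ← hσ, FreePerm.inv_act_mul_act, norm_freePerm])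
  have hact : ∀ h n, (j h).act (ℓ n) = ℓ (onInt (τ h) n) := fun h n => by rw [hτ, hσ]
  have hstep : ∀ h n, ℓ (onInt (τ h) (n + 1)) =
      ℓ (onInt (τ h) n) * FreeGroup.mk [((j h).right • (y n).1, (y n).2)] := fun h n => by
    rw [← hact, line.step, FreePerm.act_mul_right, hact, freePerm_letter]
  have letter_inj : ∀ z z' : E × Bool, FreeGroup.mk [z] = FreeGroup.mk [z'] → z = z' := by
    intro z z' h
    have := congrArg FreeGroup.toWord h
    rw [FreeGroup.toWord_mk, FreeGroup.toWord_mk, FreeGroup.IsReduced.singleton.reduce_eq,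
      FreeGroup.IsReduced.singleton.reduce_eq] at this
    exact List.singleton_inj.1 this
  refine ⟨τ, (y 0).1, ⟨k, by omega, ?_⟩, fun h hh => ⟨?_, fun hr => ?_⟩, fun h i hh => ?_⟩
  · apply onInt_injective
    funext n
    apply line.injective
    rw [← hact, h₀a, FreePerm.act_inl, hℓ, onInt_rot]
  · have h1 := hstep h 0
    have hid : ∀ n, onInt (τ h) n = n := fun n => by
      rw [hh, ← rot_zero, onInt_rot, add_zero]
    rw [hid, hid, line.step] at h1
    exact (congrArg Prod.fst (letter_inj _ _ (mul_left_cancel h1))).symm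
  · have h1 := hact h 0
    rw [hh, ← rot_zero, onInt_rot, FreePerm.act, hr, map_one, MulAut.one_apply, add_zero,
      mul_eq_right] at h1
    exact SemidirectProduct.ext h1 hr
  -- The reflection is `n ↦ -(n + i)`. For odd `i` an edge of the axis would be inverted, but letters
  -- keep their signs; for `i = 2 m` the vertex `ℓ (-m)` is fixed.
  · have hflip : ∀ n, y (-(n + i) - 1) = ((j h).right • (y n).1, !(y n).2) := fun n => by
      have h1 := hstep h n
      rw [hh, onInt_mirror, onInt_mirror] at h1
      have h2 := line.step (-(n + i) - 1)
      rw [sub_add_cancel, show -(n + i) - 1 = -(n + 1 + i) by ring, h1, mul_assoc,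
        left_eq_mul, mul_eq_one_iff_inv_eq, FreeGroup.mk_singleton_inv] at h2
      rw [show -(n + i) - 1 = -(n + 1 + i) by ring]
      exact (letter_inj _ _ h2).symm
    rcases Int.even_or_odd' i with ⟨m, hm | hm⟩
    · have h1 := hflip (-m)
      have h2 := hflip (-m - 1)
      rw [show -(-m + i) - 1 = -m - 1 by omega] at h1
      rw [show -(-m - 1 + i) - 1 = -m by omega] at h2
      have e1 : (y (-m - 1)).1 = (j h).right • (y (-m)).1 := by rw [h1]
      have e2 : (y (-m)).1 = (j h).right • (y (-m - 1)).1 := by rw [h2]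
      refine ⟨(y (-m)).1, fun he => ?_, by rw [← e1, ← e2]⟩
      have red := line.reduced (-m - 1)
      rw [sub_add_cancel] at red
      have h3 := red (e1.trans he)
      have h4 : (y (-m - 1)).2 = !(y (-m)).2 := by rw [h1]
      rw [h4] at h3
      simp at h3
    · have h1 := hflip (-m - 1)
      rw [show -(-m - 1 + i) - 1 = -m - 1 by omega] at h1
      have h2 := congrArg Prod.snd h1
      simp at h2

end FreePerm

/-! ### Subgroups of free groups without free subgroups of rank two -/

section Cyclic

open DihedralGroup

/-- By the Nielsen–Schreier theorem, a nontrivial group without a copy of `F₂` that embeds in a free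
group is generated by one element. -/
theorem eq_one_or_exists_generator {K : Type w} [Group K] {E : Type*} (f : K →* FreeGroup E)
    (hf : Function.Injective f) (hK : ¬ ContainsFreeGroupTwo K) :
    (∀ g : K, g = 1) ∨ ∃ a : K, a ≠ 1 ∧ ∀ g : K, ∃ n : ℤ, g = a ^ n := by
  have e : K ≃* f.range := MonoidHom.ofInjective hf
  set X := IsFreeGroup.Generators f.range
  let θ : FreeGroup X ≃* K := (IsFreeGroup.toFreeGroup f.range).symm.trans e.symm
  by_cases hX : Subsingleton X
  · rcases isEmpty_or_nonempty X with hX' | ⟨⟨x⟩⟩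
    · left
      intro g
      have : θ.symm g = 1 := Subsingleton.elim _ _
      rwa [MulEquiv.map_eq_one_iff] at this
    · right
      refine ⟨θ (FreeGroup.of x), by simp, fun g => ?_⟩
      have : θ.symm g ∈ Subgroup.zpowers (FreeGroup.of x) := by
        generalize θ.symm g = w
        induction w using FreeGroup.induction_on with
        | C1 => exact one_mem _
        | of z => rw [Subsingleton.elim z x]; exact Subgroup.mem_zpowers _
        | inv_of z hz => exact inv_mem hz
        | mul a b ha hb => exact mul_mem ha hb
      obtain ⟨n, hn⟩ := this
      refine ⟨n, ?_⟩
      rw [← map_zpow, ← MulEquiv.symm_apply_eq]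
      exact hn.symm
  · exfalso
    rw [not_subsingleton_iff_nontrivial] at hX
    obtain ⟨x, x', hx⟩ := hX
    refine hK ⟨θ.toMonoidHom.comp (FreeGroup.map ![x, x']),
      θ.injective.comp (FreeGroup.map_injective ?_)⟩
    intro i i' h
    fin_cases i <;> fin_cases i' <;> simp_all [eq_comm]

/-- A group without a copy of `F₂` that embeds in `FreeGroup E ⋊ P` either embeds in `P` or maps to
the infinite dihedral group in the way described in `FreePerm.exists_hom_dihedral`. -/
theorem FreePerm.injective_or_exists_hom_dihedral {P E : Type*} [Group P] [MulAction P E]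
    {H : Type w} [Group H] (j : H →* FreePerm P E) (hj : Function.Injective j)
    (hH : ¬ ContainsFreeGroupTwo H) :
    (∀ h, (j h).right = 1 → h = 1) ∨
    ∃ (τ : H →* DihedralGroup 0) (e : E),
      (∃ h i, i ≠ 0 ∧ τ h = rot i) ∧
      (∀ h, τ h = 1 → (j h).right • e = e ∧ ((j h).right = 1 → h = 1)) ∧
      ∀ h i, τ h = mirror i →
        ∃ e' : E, (j h).right • e' ≠ e' ∧ (j h).right • (j h).right • e' = e' := by
  let K : Subgroup H := (SemidirectProduct.rightHom.comp j).ker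
  have hK : ∀ h, h ∈ K ↔ (j h).right = 1 := fun h => Iff.rfl
  have hKN : K.Normal := inferInstance
  have hinl : ∀ h ∈ K, j h = SemidirectProduct.inl (j h).left := fun h hh =>
    SemidirectProduct.ext rfl ((hK h).1 hh)
  let f : K →* FreeGroup E := MonoidHom.mk' (fun h => (j h).left) (fun g h => by
    rw [Subgroup.coe_mul, map_mul, SemidirectProduct.mul_left, (hK g).1 g.2, map_one,
      MulAut.one_apply])
  have hf : Function.Injective f := fun g h e => by
    apply Subtype.ext
    apply hj
    rw [hinl g g.2, hinl h h.2]
    exact congrArg _ e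
  have hK2 : ¬ ContainsFreeGroupTwo K := fun ⟨g, hg⟩ =>
    hH ⟨K.subtype.comp g, K.subtype_injective.comp hg⟩
  rcases eq_one_or_exists_generator f hf hK2 with h1 | ⟨a, ha, hgen⟩
  · left
    intro h hh
    exact congrArg Subtype.val (h1 ⟨h, (hK h).2 hh⟩)
  right
  have hfa : f a ≠ 1 := fun h => ha (hf (h.trans (map_one f).symm))
  have hconj : ∀ h : H, ∃ m : ℤ, h * a * h⁻¹ = (a : H) ^ m := fun h => by
    obtain ⟨m, hm⟩ := hgen ⟨h * a * h⁻¹, hKN.conj_mem a a.2 h⟩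
    exact ⟨m, by simpa using congrArg Subtype.val hm⟩
  have hpm : ∀ h : H, h⁻¹ * a * h = a ∨ h⁻¹ * a * h = (a : H)⁻¹ := fun h => by
    obtain ⟨m, hm⟩ := hconj h⁻¹
    obtain ⟨n, hn⟩ := hconj h
    rw [inv_inv] at hm
    have h1 : (a : H) = (a : H) ^ (n * m) := by
      rw [zpow_mul, ← hn, conj_zpow, ← hm]
      group
    have h2 : a ^ (n * m - 1) = 1 := by
      apply Subtype.ext
      rw [zpow_sub_one, Subgroup.coe_mul, Subgroup.coe_zpow, ← h1]
      simp
    have h3 : f a ^ (n * m - 1) = 1 := by rw [← map_zpow, h2, map_one]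
    have h4 : n * m = 1 := by
      have := (IsMulTorsionFree.zpow_eq_one_iff_right hfa).1 h3
      omega
    rcases Int.eq_one_or_neg_one_of_mul_eq_one (by rwa [mul_comm] at h4 : m * n = 1)
      with rfl | rfl
    · left; rw [hm, zpow_one]
    · right; rw [hm, zpow_neg_one]
  obtain ⟨τ, e, ⟨i, hi, hτ⟩, hker, hrefl⟩ := FreePerm.exists_hom_dihedral j hfa (h₀ := a)
    (hinl a a.2) (fun h => by
      rw [show SemidirectProduct.inl (f a) = j a from (hinl a a.2).symm, map_inv,
        show SemidirectProduct.inl (f a) = j a from (hinl a a.2).symm, ← map_inv, ← map_mul,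
        ← map_mul, ← map_mul]
      rcases hpm h with hh | hh
      · left; rw [show (a : H) * h = h * (h⁻¹ * a * h) by group, hh]
      · right; rw [show (a : H) * h = h * (h⁻¹ * a * h) by group, hh])
  refine ⟨τ, e, ⟨a, i, hi, hτ⟩, fun h hh => ⟨(hker h hh).1, fun hr => hj ?_⟩, hrefl⟩
  rw [(hker h hh).2 hr, map_one]

end Cyclic

/-! ### Free products with permuted factors -/

section IndexPerm

open Monoid

variable (R Y A : Type*) [Group R] [MulAction R Y] [Group A]

/-- The factor with index `y` in a free product of copies of `A`. -/
def copy {Y A : Type*} [Group A] (y : Y) : A →* CoprodI fun _ : Y => A :=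
  CoprodI.of (M := fun _ : Y => A) (i := y)

/-- The action of `R` on the free product of copies of `A` indexed by an `R`-set `Y` that permutes
the copies. -/
def indexPerm : R →* MulAut (CoprodI fun _ : Y => A) :=
  let f : R → (CoprodI fun _ : Y => A) →* CoprodI fun _ : Y => A := fun r =>
    CoprodI.lift fun y => copy (r • y)
  have f_mul : ∀ r r', f (r * r') = (f r).comp (f r') := fun r r' => by
    refine CoprodI.ext_hom _ _ fun y => MonoidHom.ext fun a => ?_
    simp only [f, MonoidHom.comp_apply, CoprodI.lift_of, mul_smul, copy]
  have f_one : f 1 = MonoidHom.id _ := by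
    refine CoprodI.ext_hom _ _ fun y => MonoidHom.ext fun a => ?_
    simp only [f, MonoidHom.comp_apply, CoprodI.lift_of, one_smul, MonoidHom.id_apply, copy]
  MonoidHom.mk' (fun r => MonoidHom.toMulEquiv (f r) (f r⁻¹)
    (by rw [← f_mul, inv_mul_cancel, f_one]) (by rw [← f_mul, mul_inv_cancel, f_one]))
    fun r r' => MulEquiv.ext fun x => DFunLike.congr_fun (f_mul r r') x

variable {R Y A}

theorem indexPerm_copy (r : R) (y : Y) (a : A) :
    indexPerm R Y A r (copy y a) = copy (r • y) a :=
  CoprodI.lift_of (M := fun _ : Y => A) (fun y => copy (r • y)) a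

end IndexPerm

/-! ### Graph products and their retractions -/

namespace GraphProduct

open Monoid

variable {V : Type u} {Γ : SimpleGraph V} {G : V → Type v} [∀ s, Group (G s)]

/-- The embedding of a vertex group into the graph product. -/
def of (s : V) : G s →* GraphProduct Γ G := (QuotientGroup.mk' _).comp CoprodI.of

theorem commute_of {s t : V} (h : Γ.Adj s t) (a : G s) (b : G t) :
    Commute (of (Γ := Γ) s a) (of t b) := by
  have hmem : CoprodI.of a * CoprodI.of b * (CoprodI.of a)⁻¹ * (CoprodI.of b)⁻¹ ∈
      Subgroup.normalClosure (graphProductRelators Γ G) :=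
    Subgroup.subset_normalClosure ⟨s, t, a, b, h, rfl⟩
  rw [← QuotientGroup.eq_one_iff] at hmem
  exact mul_inv_eq_iff_eq_mul.1 (mul_inv_eq_one.1 hmem)

/-- The universal property of the graph product. -/
def lift {K : Type*} [Group K] (f : ∀ s, G s →* K)
    (hf : ∀ s t, Γ.Adj s t → ∀ a b, Commute (f s a) (f t b)) : GraphProduct Γ G →* K :=
  QuotientGroup.lift _ (CoprodI.lift f) fun x hx => by
    suffices h : Subgroup.normalClosure (graphProductRelators Γ G) ≤ (CoprodI.lift f).ker from h hx
    refine Subgroup.normalClosure_le_normal ?_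
    rintro _ ⟨s, t, a, b, h, rfl⟩
    rw [SetLike.mem_coe, MonoidHom.mem_ker]
    simp only [map_mul, map_inv, CoprodI.lift_of]
    rw [(hf s t h a b).eq]
    group

@[simp]
theorem lift_of {K : Type*} [Group K] (f : ∀ s, G s →* K)
    (hf : ∀ s t, Γ.Adj s t → ∀ a b, Commute (f s a) (f t b)) (s : V) (a : G s) :
    lift f hf (of s a) = f s a :=
  CoprodI.lift_of f a

theorem induction_on {p : GraphProduct Γ G → Prop} (g : GraphProduct Γ G) (one : p 1)
    (of : ∀ s a, p (of s a)) (mul : ∀ g h, p g → p h → p (g * h)) : p g := by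
  obtain ⟨x, rfl⟩ := QuotientGroup.mk_surjective g
  induction x using CoprodI.induction_on with
  | one => exact one
  | of s a => exact of s a
  | mul x y hx hy => exact mul _ _ hx hy

theorem hom_ext {K : Type*} [Group K] {f f' : GraphProduct Γ G →* K}
    (h : ∀ s a, f (of s a) = f' (of s a)) : f = f' := by
  refine MonoidHom.ext fun g => ?_
  induction g using induction_on with
  | one => rw [map_one, map_one]
  | of s a => exact h s a
  | mul x y hx hy => rw [map_mul, map_mul, hx, hy]

variable (Γ G) in
open Classical in
/-- The retraction of the graph product onto the parabolic subgroup generated by the vertex groups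
with index in `S`, as an endomorphism: it kills the other vertex groups. -/
noncomputable def retract (S : Set V) : GraphProduct Γ G →* GraphProduct Γ G :=
  lift (fun s => if s ∈ S then of s else 1) fun s t h a b => by
    split_ifs
    · exact commute_of h a b
    · exact Commute.one_right _
    · exact Commute.one_left _
    · exact Commute.one_left _

theorem retract_of_mem {S : Set V} {s : V} (hs : s ∈ S) (a : G s) :
    retract Γ G S (of s a) = of s a := by
  rw [retract, lift_of, if_pos hs]

theorem retract_of_notMem {S : Set V} {s : V} (hs : s ∉ S) (a : G s) :
    retract Γ G S (of s a) = 1 := by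
  rw [retract, lift_of, if_neg hs, MonoidHom.one_apply]

theorem retract_retract (S T : Set V) (g : GraphProduct Γ G) :
    retract Γ G S (retract Γ G T g) = retract Γ G (S ∩ T) g := by
  suffices h : (retract Γ G S).comp (retract Γ G T) = retract Γ G (S ∩ T) from
    DFunLike.congr_fun h g
  refine hom_ext fun s a => ?_
  rw [MonoidHom.comp_apply]
  by_cases hT : s ∈ T
  · rw [retract_of_mem hT]
    by_cases hS : s ∈ S
    · rw [retract_of_mem hS, retract_of_mem (S := S ∩ T) ⟨hS, hT⟩]
    · rw [retract_of_notMem hS, retract_of_notMem fun h => hS h.1]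
  · rw [retract_of_notMem hT, retract_of_notMem fun h => hT h.2, map_one]

theorem retract_retract_of_subset {S T : Set V} (h : S ⊆ T) (g : GraphProduct Γ G) :
    retract Γ G T (retract Γ G S g) = retract Γ G S g := by
  rw [retract_retract, Set.inter_eq_self_of_subset_right h]

theorem retract_retract_of_superset {S T : Set V} (h : S ⊆ T) (g : GraphProduct Γ G) :
    retract Γ G S (retract Γ G T g) = retract Γ G S g := by
  rw [retract_retract, Set.inter_eq_self_of_subset_left h]

theorem mem_range_retract {S : Set V} {g : GraphProduct Γ G} :
    g ∈ (retract Γ G S).range ↔ retract Γ G S g = g :=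
  ⟨by rintro ⟨x, rfl⟩; exact retract_retract_of_subset le_rfl x, fun h => ⟨g, h⟩⟩

theorem retract_univ (g : GraphProduct Γ G) : retract Γ G Set.univ g = g :=
  DFunLike.congr_fun (hom_ext (f := retract Γ G Set.univ) (f' := MonoidHom.id _)
    fun s a => retract_of_mem (Set.mem_univ s) a) g

theorem retract_empty (g : GraphProduct Γ G) : retract Γ G ∅ g = 1 :=
  DFunLike.congr_fun (hom_ext (f := retract Γ G ∅) (f' := 1)
    fun s a => retract_of_notMem (Set.notMem_empty s) a) g

theorem commute_retract {S T : Set V} (h : ∀ s ∈ S, ∀ t ∈ T, Γ.Adj s t)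
    (x y : GraphProduct Γ G) : Commute (retract Γ G S x) (retract Γ G T y) := by
  induction x using induction_on with
  | one => rw [map_one]; exact Commute.one_left _
  | mul x x' hx hx' => rw [map_mul]; exact hx.mul_left hx'
  | of s a =>
    by_cases hs : s ∈ S
    · rw [retract_of_mem hs]
      induction y using induction_on with
      | one => rw [map_one]; exact Commute.one_right _
      | mul y y' hy hy' => rw [map_mul]; exact hy.mul_right hy'
      | of t b =>
        by_cases ht : t ∈ T
        · rw [retract_of_mem ht]; exact commute_of (h s hs t ht) a b
        · rw [retract_of_notMem ht]; exact Commute.one_right _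
    · rw [retract_of_notMem hs]; exact Commute.one_left _

variable (Γ G) in
open Classical in
/-- The projection of the graph product onto a vertex group. -/
noncomputable def proj (v : V) : GraphProduct Γ G →* G v :=
  lift (Pi.mulSingle v (MonoidHom.id (G v))) fun s t h a b => by
    by_cases hs : s = v
    · have ht : t ≠ v := fun ht => h.ne (hs.trans ht.symm)
      rw [Pi.mulSingle_eq_of_ne ht]
      exact Commute.one_right _
    · rw [Pi.mulSingle_eq_of_ne hs]
      exact Commute.one_left _

open Classical in
theorem proj_of_self (v : V) (a : G v) : proj Γ G v (of v a) = a := by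
  rw [proj, lift_of, Pi.mulSingle_eq_same, MonoidHom.id_apply]

open Classical in
theorem proj_of_ne {v s : V} (h : s ≠ v) (a : G s) : proj Γ G v (of s a) = 1 := by
  rw [proj, lift_of, Pi.mulSingle_eq_of_ne h, MonoidHom.one_apply]

theorem of_proj (v : V) (g : GraphProduct Γ G) : of v (proj Γ G v g) = retract Γ G {v} g := by
  refine DFunLike.congr_fun (hom_ext (f := (of v).comp (proj Γ G v)) fun s a => ?_) g
  rw [MonoidHom.comp_apply]
  by_cases h : s = v
  · subst h
    rw [proj_of_self, retract_of_mem (Set.mem_singleton s)]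
  · rw [proj_of_ne h, map_one, retract_of_notMem (S := {v}) h]

theorem proj_retract_of_notMem {v : V} {T : Set V} (h : v ∉ T) (g : GraphProduct Γ G) :
    proj Γ G v (retract Γ G T g) = 1 := by
  refine DFunLike.congr_fun (hom_ext (f := (proj Γ G v).comp (retract Γ G T)) (f' := 1)
    fun s a => ?_) g
  rw [MonoidHom.comp_apply]
  by_cases hs : s ∈ T
  · rw [retract_of_mem hs, proj_of_ne (by rintro rfl; exact h hs)]; rfl
  · rw [retract_of_notMem hs, map_one]; rfl

/-! ### Separating a vertex -/

variable (Γ G) in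
/-- The parabolic subgroup generated by the vertex groups with index in `T`. -/
noncomputable abbrev parabolic (T : Set V) : Subgroup (GraphProduct Γ G) := (retract Γ G T).range

variable (Γ) in
/-- The neighbours of `v` in `T`. -/
def link (v : V) (T : Set V) : Set V := {s ∈ T | Γ.Adj v s}

variable (Γ G) in
/-- The parabolic subgroup of the link of `v` in `T`, inside the parabolic subgroup of `T`. -/
noncomputable def linkSubgroup (v : V) (T : Set V) : Subgroup (parabolic Γ G T) :=
  (parabolic Γ G (link Γ v T)).subgroupOf _

theorem mem_linkSubgroup {v : V} {T : Set V} {q : parabolic Γ G T} :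
    q ∈ linkSubgroup Γ G v T ↔ retract Γ G (link Γ v T) q = (q : GraphProduct Γ G) := by
  rw [linkSubgroup, Subgroup.mem_subgroupOf, mem_range_retract]

theorem retract_coe {T : Set V} (q : parabolic Γ G T) :
    retract Γ G T q = (q : GraphProduct Γ G) := mem_range_retract.1 q.2

section Amalgam

variable {v : V} {T : Set V} {K : Type*} [Group K] (fA : G v →* K) (fQ : parabolic Γ G T →* K)
  (hcomm : ∀ a, ∀ q ∈ linkSubgroup Γ G v T, Commute (fA a) (fQ q))

open Classical in
/-- The homomorphism defined on the graph product by a homomorphism on the group of the vertex `v` and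
one on the parabolic subgroup of `T` whose values on the link of `v` commute with those of the first;
vertex groups outside `T ∪ {v}` are killed. -/
noncomputable def amalgam : GraphProduct Γ G →* K :=
  lift (fun s => if s = v then fA.comp ((proj Γ G v).comp (of s)) else
    fQ.comp ((retract Γ G T).rangeRestrict.comp (of s))) <| by
    have key : ∀ t, Γ.Adj v t → ∀ a (b : G t),
        Commute (fA a) (fQ ((retract Γ G T).rangeRestrict (of t b))) := fun t h a b => by
      refine hcomm _ _ (mem_linkSubgroup.2 ?_)
      rw [MonoidHom.coe_rangeRestrict]
      by_cases ht : t ∈ T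
      · rw [retract_of_mem ht, retract_of_mem (S := link Γ v T) ⟨ht, h⟩]
      · rw [retract_of_notMem ht, map_one]
    intro s t h a b
    split_ifs with hs ht ht
    · exact absurd (hs.trans ht.symm) h.ne
    · subst hs
      exact key t h _ b
    · subst ht
      exact (key s h.symm _ a).symm
    · exact ((commute_of h a b).map (retract Γ G T).rangeRestrict).map fQ

theorem amalgam_of_self (a : G v) : amalgam fA fQ hcomm (of v a) = fA a := by
  rw [amalgam, lift_of, if_pos rfl]
  simp only [MonoidHom.comp_apply, proj_of_self]

theorem amalgam_of_ne {s : V} (h : s ≠ v) (a : G s) :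
    amalgam fA fQ hcomm (of s a) = fQ ((retract Γ G T).rangeRestrict (of s a)) := by
  rw [amalgam, lift_of, if_neg h]
  rfl

theorem comp_amalgam {K' : Type*} [Group K'] (f : K →* K') (g : GraphProduct Γ G) :
    f (amalgam fA fQ hcomm g) =
      amalgam (f.comp fA) (f.comp fQ) (fun a q hq => (hcomm a q hq).map f) g := by
  refine DFunLike.congr_fun (hom_ext (f := f.comp (amalgam fA fQ hcomm)) fun s a => ?_) g
  rw [MonoidHom.comp_apply]
  by_cases h : s = v
  · subst h
    simp only [amalgam_of_self, MonoidHom.comp_apply]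
  · simp only [amalgam_of_ne _ _ _ h, MonoidHom.comp_apply]

theorem amalgam_retract (hv : v ∉ T) (g : GraphProduct Γ G) :
    amalgam fA fQ hcomm (retract Γ G T g) = fQ ((retract Γ G T).rangeRestrict g) := by
  refine DFunLike.congr_fun (hom_ext (f := (amalgam fA fQ hcomm).comp (retract Γ G T))
    (f' := fQ.comp (retract Γ G T).rangeRestrict) fun s a => ?_) g
  rw [MonoidHom.comp_apply, MonoidHom.comp_apply]
  by_cases h : s ∈ T
  · rw [retract_of_mem h, amalgam_of_ne _ _ _ (by rintro rfl; exact hv h)]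
  · have : (retract Γ G T).rangeRestrict (of s a) = 1 := Subtype.ext (retract_of_notMem h a)
    rw [retract_of_notMem h, this, map_one, map_one]

end Amalgam

theorem commute_linkSubgroup {v : V} {T : Set V} (a : G v) (q : parabolic Γ G T)
    (hq : q ∈ linkSubgroup Γ G v T) :
    Commute (of (Γ := Γ) v a) ((parabolic Γ G T).subtype q) := by
  rw [Subgroup.subtype_apply, ← mem_linkSubgroup.1 hq,
    ← retract_of_mem (Set.mem_singleton v) (Γ := Γ)]
  refine commute_retract (fun s hs t ht => ?_) _ _
  rw [Set.mem_singleton_iff.1 hs]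
  exact ht.2

theorem amalgam_of_subtype {v : V} {T : Set V} (hv : v ∉ T) (g : GraphProduct Γ G) :
    amalgam (of v) (parabolic Γ G T).subtype commute_linkSubgroup g =
      retract Γ G (insert v T) g := by
  refine DFunLike.congr_fun (hom_ext fun s a => ?_) g
  by_cases h : s = v
  · subst h
    rw [amalgam_of_self, retract_of_mem (Set.mem_insert s T)]
  · rw [amalgam_of_ne _ _ _ h, Subgroup.subtype_apply, MonoidHom.coe_rangeRestrict]
    by_cases hs : s ∈ T
    · rw [retract_of_mem hs, retract_of_mem (Set.mem_insert_of_mem v hs)]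
    · rw [retract_of_notMem hs, retract_of_notMem]
      simp [h, hs]

theorem amalgam_inl_inr {v : V} {T : Set V} (hv : v ∉ T) (g : GraphProduct Γ G) :
    amalgam (MonoidHom.inl (G v) (parabolic Γ G T)) (MonoidHom.inr (G v) (parabolic Γ G T))
      (fun a q _ => MonoidHom.commute_inl_inr a q) g =
      (proj Γ G v g, (retract Γ G T).rangeRestrict g) := by
  refine DFunLike.congr_fun (hom_ext
    (f' := (proj Γ G v).prod (retract Γ G T).rangeRestrict) fun s a => ?_) g
  rw [MonoidHom.prod_apply]
  by_cases h : s = v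
  · subst h
    rw [amalgam_of_self, proj_of_self]
    exact Prod.ext rfl (Subtype.ext (retract_of_notMem hv a).symm)
  · rw [amalgam_of_ne _ _ _ h, proj_of_ne h]
    rfl

end GraphProduct

/-! ### Embedding a parabolic subgroup into a free group extended by a direct product -/

section Letters

variable (A : Type*) {Q : Type*} [Group A] [Group Q] (L : Subgroup Q)

/-- The set `A × Q / L`, with the componentwise action of `A × Q`. It is a type of its own because the
product type already carries other actions. -/
def Letters : Type _ := A × (Q ⧸ L)

instance : MulAction (A × Q) (Letters A L) where
  smul p e := (p.1 * e.1, p.2 • e.2)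
  one_smul _ := Prod.ext (one_mul _) (one_smul _ _)
  mul_smul _ _ _ := Prod.ext (mul_assoc _ _ _) (mul_smul _ _ _)

variable {A L}

/-- The letter `(a, x)`. -/
def Letters.mk (a : A) (x : Q ⧸ L) : Letters A L := (a, x)

/-- The letter `(1, L)`. -/
def Letters.base : Letters A L := Letters.mk 1 ((1 : Q) : Q ⧸ L)

open SemidirectProduct

/-- The conjugate of the factor `A` of `A × Q` by the letter `(1, L)`. -/
def Letters.homA : A →* FreePerm (A × Q) (Letters A L) :=
  (MulAut.conj (inl (FreeGroup.of Letters.base))).toMonoidHom.comp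
    (inr.comp (MonoidHom.inl A Q))

/-- The factor `Q` of `A × Q`. -/
def Letters.homQ : Q →* FreePerm (A × Q) (Letters A L) := inr.comp (MonoidHom.inr A Q)

theorem Letters.homA_apply (a : A) : Letters.homA (L := L) a =
    inl (FreeGroup.of Letters.base) * inr (a, 1) * (inl (FreeGroup.of Letters.base))⁻¹ := rfl

theorem Letters.homQ_apply (q : Q) : Letters.homQ (A := A) (L := L) q = inr (1, q) := rfl

theorem Letters.commute (a : A) (q : Q) (hq : q ∈ L) :
    Commute (Letters.homA (L := L) a) (Letters.homQ q) := by
  rw [Letters.homA_apply, Letters.homQ_apply]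
  have h1 : Commute (inl (FreeGroup.of Letters.base) : FreePerm (A × Q) (Letters A L))
      (inr (1, q)) := by
    have h := inl_aut (φ := freePerm (A × Q) (Letters A L)) (1, q) (FreeGroup.of Letters.base)
    have hb : ((1, q) : A × Q) • (Letters.base : Letters A L) = Letters.base :=
      Prod.ext (one_mul _) (by
        change ((q * 1 : Q) : Q ⧸ L) = ((1 : Q) : Q ⧸ L)
        rw [QuotientGroup.eq]; simpa using hq)
    rw [freePerm_of, hb, map_inv] at h
    exact eq_mul_inv_iff_mul_eq.1 h
  have h2 : Commute (inr (a, 1) : FreePerm (A × Q) (Letters A L)) (inr (1, q)) :=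
    Commute.map (MonoidHom.commute_inl_inr a q) inr
  exact (h1.mul_left h2).mul_left h1.inv_left

end Letters

namespace GraphProduct

open SemidirectProduct Monoid

variable {V : Type u} {Γ : SimpleGraph V} {G : V → Type v} [∀ s, Group (G s)]

variable (Γ G) in
/-- The letters attached to a vertex `v` and a set `T` of other vertices. -/
abbrev VertexLetters (v : V) (T : Set V) : Type _ := Letters (G v) (linkSubgroup Γ G v T)

variable (Γ G) in
/-- The homomorphism to a semidirect product of a free group with the direct product of the vertex
group of `v` and the parabolic subgroup of `T`: the group of `v` is conjugated by a letter that
commutes with the link of `v`. -/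
noncomputable def toFreePerm (v : V) (T : Set V) :
    GraphProduct Γ G →* FreePerm (G v × parabolic Γ G T) (VertexLetters Γ G v T) :=
  amalgam Letters.homA Letters.homQ Letters.commute

theorem toFreePerm_right {v : V} {T : Set V} (hv : v ∉ T) (g : GraphProduct Γ G) :
    (toFreePerm Γ G v T g).right = (proj Γ G v g, (retract Γ G T).rangeRestrict g) := by
  rw [← amalgam_inl_inr hv]
  refine (comp_amalgam _ _ _ rightHom g).trans ?_
  congr 2
  ext a <;> simp [Letters.homA_apply]

theorem toFreePerm_retract {v : V} {T : Set V} (hv : v ∉ T) (g : GraphProduct Γ G) :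
    toFreePerm Γ G v T (retract Γ G T g) = inr (1, (retract Γ G T).rangeRestrict g) :=
  amalgam_retract _ _ _ hv g

/-! ### Injectivity of the embedding

With `X` the set of cosets of the link subgroup, the free product of copies of `G v` indexed by
`FreeGroup X` extended by `FreeGroup X ⋊ parabolic Γ G T` receives homomorphisms from the target of
`toFreePerm` and from the graph product, and they are compatible: the letter `(1, x)` goes to the
generator `x`, which conjugates the copy with index `1` to the copy with index `x`. The copies whose
index is a letter give back the conjugates of `G v` by the elements of the parabolic subgroup, so that
the second homomorphism is injective on the parabolic subgroup of `T ∪ {v}`. -/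

section Injectivity

variable (Γ G) (v : V) (T : Set V)

/-- The cosets of the link of `v` in the parabolic subgroup of `T`. -/
abbrev Cosets : Type _ := parabolic Γ G T ⧸ linkSubgroup Γ G v T

/-- The free group on the cosets of the link, extended by the parabolic subgroup of `T`. -/
abbrev CosetPerm : Type _ := FreePerm (parabolic Γ G T) (Cosets Γ G v T)

/-- The free product of copies of the group of `v` indexed by the free group on the cosets of the
link. -/
abbrev Copies : Type _ := CoprodI fun _ : FreeGroup (Cosets Γ G v T) => G v

/-- `Copies` extended by `CosetPerm`. -/
abbrev BigPerm : Type _ :=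
  Copies Γ G v T ⋊[indexPerm (CosetPerm Γ G v T) (FreeGroup (Cosets Γ G v T)) (G v)]
    CosetPerm Γ G v T

/-- `Copies` extended by the parabolic subgroup of `T`. -/
abbrev SmallPerm : Type _ :=
  Copies Γ G v T ⋊[(indexPerm (CosetPerm Γ G v T) (FreeGroup (Cosets Γ G v T)) (G v)).comp inr]
    parabolic Γ G T

/-- The embedding of `SmallPerm` into `BigPerm`. -/
noncomputable def smallToBig : SmallPerm Γ G v T →* BigPerm Γ G v T :=
  SemidirectProduct.map (MonoidHom.id _) inr fun _ => rfl

variable {Γ G v T}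

theorem smallToBig_injective : Function.Injective (smallToBig Γ G v T) := fun _ _ h =>
  have h1 := congrArg SemidirectProduct.left h
  have h2 := congrArg SemidirectProduct.right h
  SemidirectProduct.ext h1 (inr_injective h2)

theorem conj_copy (w : CosetPerm Γ G v T) (y : FreeGroup (Cosets Γ G v T)) (a : G v) :
    (inr w : BigPerm Γ G v T) * inl (copy y a) * (inr w)⁻¹ = inl (copy (w.act y) a) := by
  rw [← map_inv, ← inl_aut, indexPerm_copy]; rfl

theorem conj_copy_small (q : parabolic Γ G T) (y : FreeGroup (Cosets Γ G v T)) (a : G v) :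
    (inr q : SmallPerm Γ G v T) * inl (copy y a) * (inr q)⁻¹ =
      inl (copy (freePerm _ _ q y) a) := by
  rw [← map_inv, ← inl_aut, MonoidHom.comp_apply, indexPerm_copy, FreePerm.smul_eq_act,
    FreePerm.act_inr]

theorem smul_base (q : parabolic Γ G T) (hq : q ∈ linkSubgroup Γ G v T) :
    q • ((1 : parabolic Γ G T) : Cosets Γ G v T) = ((1 : parabolic Γ G T) : Cosets Γ G v T) := by
  change ((q * 1 : parabolic Γ G T) : Cosets Γ G v T) = _
  rw [QuotientGroup.eq]; simpa using hq

variable (Γ G v T) in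
/-- The copy of the group of `v` indexed by the coset of `1`. -/
noncomputable def baseCopy : G v →* SmallPerm Γ G v T :=
  inl.comp (copy (FreeGroup.of ((1 : parabolic Γ G T) : Cosets Γ G v T)))

theorem commute_baseCopy (a : G v) (q : parabolic Γ G T) (hq : q ∈ linkSubgroup Γ G v T) :
    Commute (baseCopy Γ G v T a) (inr q) := by
  have h := conj_copy_small q (FreeGroup.of ((1 : parabolic Γ G T) : Cosets Γ G v T)) a
  rw [freePerm_of, smul_base q hq, mul_inv_eq_iff_eq_mul] at h
  exact h.symm

variable (Γ G v T) in
/-- The homomorphism that sends the group of `v` to the copy indexed by the coset of `1`. -/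
noncomputable def toSmallPerm : GraphProduct Γ G →* SmallPerm Γ G v T :=
  amalgam (baseCopy Γ G v T) inr commute_baseCopy

open Classical in
variable (Γ G v T) in
/-- The homomorphism on the copy with index `y`: the conjugate of `G v` by `q` if `y` is the letter
given by the coset of `q`, and trivial if `y` is not a letter. -/
noncomputable def copyHom (y : FreeGroup (Cosets Γ G v T)) : G v →* GraphProduct Γ G :=
  if h : ∃ q : parabolic Γ G T, y = FreeGroup.of (q : Cosets Γ G v T) then
    (MulAut.conj (h.choose : GraphProduct Γ G)).toMonoidHom.comp (of v) else 1

theorem copyHom_of (q : parabolic Γ G T) (a : G v) :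
    copyHom Γ G v T (FreeGroup.of (q : Cosets Γ G v T)) a =
      (q : GraphProduct Γ G) * of v a * (q : GraphProduct Γ G)⁻¹ := by
  have h : ∃ q' : parabolic Γ G T, FreeGroup.of (q : Cosets Γ G v T) =
      FreeGroup.of (q' : Cosets Γ G v T) := ⟨q, rfl⟩
  rw [copyHom, dif_pos h]
  have h2 := commute_linkSubgroup a _ (QuotientGroup.eq.1 (FreeGroup.of_injective h.choose_spec))
  set q' := h.choose
  change (q' : GraphProduct Γ G) * of v a * (q' : GraphProduct Γ G)⁻¹ = _
  have h3 : (q' : GraphProduct Γ G) =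
      q * (parabolic Γ G T).subtype (q⁻¹ * q') := by simp
  rw [h3, mul_inv_rev, mul_assoc _ _ (of v a), ← h2.eq]
  group

theorem copyHom_eq_one {y : FreeGroup (Cosets Γ G v T)}
    (hy : ¬ ∃ q : parabolic Γ G T, y = FreeGroup.of (q : Cosets Γ G v T)) :
    copyHom Γ G v T y = 1 := dif_neg hy

theorem copyHom_freePerm (q : parabolic Γ G T) (y : FreeGroup (Cosets Γ G v T)) (a : G v) :
    copyHom Γ G v T (freePerm _ _ q y) a =
      (q : GraphProduct Γ G) * copyHom Γ G v T y a * (q : GraphProduct Γ G)⁻¹ := by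
  by_cases hy : ∃ q' : parabolic Γ G T, y = FreeGroup.of (q' : Cosets Γ G v T)
  · obtain ⟨q', rfl⟩ := hy
    have h : q • (q' : Cosets Γ G v T) = ((q * q' : parabolic Γ G T) : Cosets Γ G v T) := rfl
    rw [freePerm_of, h, copyHom_of, copyHom_of, Subgroup.coe_mul]
    group
  · rw [copyHom_eq_one hy, copyHom_eq_one]
    · simp
    · rintro ⟨q', hq'⟩
      refine hy ⟨q⁻¹ * q', ?_⟩
      have h : q⁻¹ • (q' : Cosets Γ G v T) = ((q⁻¹ * q' : parabolic Γ G T) : Cosets Γ G v T) :=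
        rfl
      rw [← h, ← freePerm_of, ← hq', map_inv, MulAut.inv_apply_self]

variable (Γ G v T) in
/-- The homomorphism that inverts `toSmallPerm` on the parabolic subgroup of `T ∪ {v}`. -/
noncomputable def ofSmallPerm : SmallPerm Γ G v T →* GraphProduct Γ G :=
  SemidirectProduct.lift (CoprodI.lift (copyHom Γ G v T)) (parabolic Γ G T).subtype fun q => by
    refine CoprodI.ext_hom _ _ fun y => MonoidHom.ext fun a => ?_
    change CoprodI.lift (copyHom Γ G v T) (indexPerm _ _ _ (inr q) (copy y a)) =
      (q : GraphProduct Γ G) * CoprodI.lift (copyHom Γ G v T) (copy y a) *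
        (q : GraphProduct Γ G)⁻¹
    rw [indexPerm_copy, FreePerm.smul_eq_act, FreePerm.act_inr, copy, copy, CoprodI.lift_of,
      CoprodI.lift_of, copyHom_freePerm]

theorem ofSmallPerm_toSmallPerm (hv : v ∉ T) (g : GraphProduct Γ G) :
    ofSmallPerm Γ G v T (toSmallPerm Γ G v T g) = retract Γ G (insert v T) g := by
  rw [← amalgam_of_subtype hv, toSmallPerm, comp_amalgam]
  congr 2
  · ext a
    rw [MonoidHom.comp_apply, baseCopy, MonoidHom.comp_apply, ofSmallPerm, lift_inl, copy, CoprodI.lift_of,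
      copyHom_of]
    simp
  · ext q
    rw [MonoidHom.comp_apply, ofSmallPerm, lift_inr]

variable (Γ G v T) in
/-- The image in `BigPerm` of the direct product `G v × parabolic Γ G T`. -/
noncomputable def prodToBig : G v × parabolic Γ G T →* BigPerm Γ G v T :=
  MonoidHom.noncommCoprod (inl.comp (copy 1)) (inr.comp inr) fun a q => by
    have h := conj_copy (inr q : CosetPerm Γ G v T) 1 a
    rw [FreePerm.act_inr, map_one, mul_inv_eq_iff_eq_mul] at h
    exact h.symm

theorem prodToBig_apply (a : G v) (q : parabolic Γ G T) :
    prodToBig Γ G v T (a, q) = inl (copy 1 a) * inr (inr q) := rfl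

variable (Γ G v T) in
/-- The image in `BigPerm` of the letter `(a, x)`: the conjugate of the generator `x` by `a`, where
`a` lies in the copy with index `1`. -/
noncomputable def letterToBig (e : VertexLetters Γ G v T) : BigPerm Γ G v T :=
  inl (copy 1 e.1) * inr (inl (FreeGroup.of e.2)) * (inl (copy 1 e.1))⁻¹

theorem letterToBig_mk (a : G v) (x : Cosets Γ G v T) :
    letterToBig Γ G v T (Letters.mk a x) =
      inl (copy 1 a) * inr (inl (FreeGroup.of x)) * (inl (copy 1 a))⁻¹ := rfl

theorem letterToBig_smul (b a : G v) (q : parabolic Γ G T) (x : Cosets Γ G v T) :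
    letterToBig Γ G v T (Letters.mk (b * a) (q • x)) =
      prodToBig Γ G v T (b, q) * letterToBig Γ G v T (Letters.mk a x) *
        (prodToBig Γ G v T (b, q))⁻¹ := by
  have h1 : (inr (inr q) : BigPerm Γ G v T) * inl (copy 1 a) * (inr (inr q))⁻¹ =
      inl (copy 1 a) := by
    rw [conj_copy, FreePerm.act_inr, map_one]
  have h2 : (inr (inl (FreeGroup.of (q • x))) : BigPerm Γ G v T) =
      inr (inr q) * inr (inl (FreeGroup.of x)) * (inr (inr q))⁻¹ := by
    rw [← freePerm_of, inl_aut, map_mul, map_mul, map_inv, map_inv]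
  rw [letterToBig_mk, letterToBig_mk, prodToBig_apply, h2, map_mul (copy 1), map_mul inl]
  generalize (inr (inr q) : BigPerm Γ G v T) = Q at *
  generalize (inl (copy 1 a) : BigPerm Γ G v T) = A at *
  generalize (inl (copy 1 b) : BigPerm Γ G v T) = B at *
  generalize (inr (inl (FreeGroup.of x)) : BigPerm Γ G v T) = X at *
  nth_rw 1 2 [← h1]
  group

variable (Γ G v T) in
/-- The homomorphism from the target of `toFreePerm` to `BigPerm`. -/
noncomputable def freePermToBig :
    FreePerm (G v × parabolic Γ G T) (VertexLetters Γ G v T) →* BigPerm Γ G v T :=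
  SemidirectProduct.lift (FreeGroup.lift (letterToBig Γ G v T)) (prodToBig Γ G v T) fun p => by
    refine FreeGroup.ext_hom _ _ fun e => ?_
    refine (congrArg (FreeGroup.lift _) (freePerm_of p e)).trans ?_
    rw [FreeGroup.lift_apply_of]
    refine (letterToBig_smul p.1 e.1 p.2 e.2).trans ?_
    exact congrArg (fun z => prodToBig Γ G v T p * z * (prodToBig Γ G v T p)⁻¹)
      (FreeGroup.lift_apply_of (f := letterToBig Γ G v T) (x := e)).symm

theorem freePermToBig_toFreePerm (g : GraphProduct Γ G) :
    freePermToBig Γ G v T (toFreePerm Γ G v T g) =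
      smallToBig Γ G v T (toSmallPerm Γ G v T g) := by
  rw [toFreePerm, toSmallPerm, comp_amalgam, comp_amalgam]
  congr 2
  · ext a : 1
    rw [MonoidHom.comp_apply, MonoidHom.comp_apply, Letters.homA_apply, map_mul, map_mul, map_inv,
      freePermToBig, lift_inl, lift_inr, FreeGroup.lift_apply_of, prodToBig_apply, Letters.base,
      letterToBig_mk, map_one (copy 1), map_one inl, map_one inr, map_one inr, mul_one, one_mul,
      inv_one, mul_one, conj_copy, FreePerm.act_inl, mul_one, baseCopy, MonoidHom.comp_apply,
      smallToBig, SemidirectProduct.map_inl, MonoidHom.id_apply]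
  · ext q : 1
    rw [MonoidHom.comp_apply, MonoidHom.comp_apply, Letters.homQ_apply, freePermToBig, lift_inr,
      prodToBig_apply, map_one (copy 1), map_one inl, one_mul, smallToBig,
      SemidirectProduct.map_inr]

/-- `toFreePerm` is injective on the parabolic subgroup of `T ∪ {v}`. -/
theorem retract_insert_eq_one (hv : v ∉ T) {g : GraphProduct Γ G}
    (hg : toFreePerm Γ G v T g = 1) : retract Γ G (insert v T) g = 1 := by
  have h := freePermToBig_toFreePerm (v := v) (T := T) g
  rw [hg, map_one, eq_comm, map_eq_one_iff _ smallToBig_injective] at h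
  rw [← ofSmallPerm_toSmallPerm hv, h, map_one]

end Injectivity

end GraphProduct

namespace GraphProduct

open SemidirectProduct

variable {V : Type u} {Γ : SimpleGraph V} {G : V → Type v} [∀ s, Group (G s)]

/-! ### Square roots of elements of parabolic subgroups -/

/-- If the group of `v` has no element of order two and the parabolic subgroups contained in that of
`T` are closed under square roots, then no element interchanges two letters. -/
theorem smul_letter_eq {v : V} {T : Set V} (htor : ∀ a : G v, a * a = 1 → a = 1)
    (hroot : ∀ S (g : GraphProduct Γ G), retract Γ G T g = g →
      retract Γ G S (g * g) = g * g → retract Γ G S g = g)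
    (p : G v × parabolic Γ G T) (e : VertexLetters Γ G v T) (he : p • p • e = e) :
    p • e = e := by
  obtain ⟨α, q⟩ := p
  obtain ⟨a, x, rfl⟩ : ∃ a x, e = Letters.mk a x := ⟨e.1, e.2, rfl⟩
  obtain ⟨x, rfl⟩ := QuotientGroup.mk_surjective x
  have h1 : α * (α * a) = a := congrArg Prod.fst he
  have h2 : ((q * (q * x) : parabolic Γ G T) : Cosets Γ G v T) = (x : Cosets Γ G v T) :=
    congrArg Prod.snd he
  rw [← mul_assoc, mul_eq_right] at h1
  have hα := htor α h1
  have h3 := mem_linkSubgroup.1 (QuotientGroup.eq.1 h2.symm)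
  have h4 : x⁻¹ * (q * (q * x)) = (x⁻¹ * q * x) * (x⁻¹ * q * x) := by group
  rw [h4] at h3
  have h5 : x⁻¹ * (q * x) ∈ linkSubgroup Γ G v T := by
    rw [mem_linkSubgroup, ← mul_assoc]
    exact hroot _ _ (retract_coe _) h3
  exact Prod.ext (by rw [hα]; exact one_mul a) (QuotientGroup.eq.2 h5).symm

/-- Without elements of order two in the vertex groups, parabolic subgroups are closed under square
roots. Here `g` belongs to the parabolic subgroup of `S` if and only if `retract Γ G S g = g`. -/
theorem retract_eq_of_mul_self [Finite V] (htor : ∀ s (a : G s), a * a = 1 → a = 1) (T S : Set V)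
    (g : GraphProduct Γ G) (hT : retract Γ G T g = g)
    (hS : retract Γ G S (g * g) = g * g) : retract Γ G S g = g := by
  induction hn : T.ncard using Nat.strong_induction_on generalizing T S g with
  | _ n ih =>
  by_cases hTS : T ⊆ S
  · rw [← hT, retract_retract_of_subset hTS]
  obtain ⟨v, hvT, hvS⟩ := Set.not_subset.1 hTS
  set T' := T \ {v} with hT'
  have hv : v ∉ T' := fun h => h.2 rfl
  have hins : insert v T' = T := Set.insert_sdiff_self_of_mem hvT
  have hcard : T'.ncard < n := hn ▸ Set.ncard_sdiff_singleton_lt_of_mem hvT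
  have hsub : S ∩ T ⊆ T' := fun s hs => ⟨hs.2, by rintro rfl; exact hvS hs.1⟩
  have hsq : retract Γ G T' (g * g) = g * g := by
    have hST : retract Γ G (S ∩ T) (g * g) = g * g := by
      rw [← retract_retract, map_mul (retract Γ G T), hT, hS]
    rw [← hST, retract_retract_of_subset hsub]
  set w := toFreePerm Γ G v T' g with hw
  have hww : w * w = inr (1, (retract Γ G T').rangeRestrict (g * g)) := by
    rw [hw, ← map_mul, ← toFreePerm_retract hv, hsq]
  -- Otherwise the image of `g` in `G v × parabolic Γ G T'` would interchange two letters.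
  have hleft : w.left = 1 := by
    rcases w.left_eq_one_or_swap (by rw [← mul_left, hww, left_inr]) with h | ⟨e, he, hee⟩
    · exact h
    · exact absurd (smul_letter_eq (htor v) (fun S g h1 h2 => ih _ hcard T' S g h1 h2 rfl) _ _ hee)
        he
  have hproj : proj Γ G v g = 1 := by
    apply htor
    rw [← map_mul, ← hsq, proj_retract_of_notMem hv]
  have hw' : w = toFreePerm Γ G v T' (retract Γ G T' g) := by
    rw [toFreePerm_retract hv]
    exact SemidirectProduct.ext hleft (by rw [hw, toFreePerm_right hv, hproj]; rfl)
  have hg : retract Γ G T' g = g := by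
    have h1 : toFreePerm Γ G v T' (g⁻¹ * retract Γ G T' g) = 1 := by
      rw [map_mul, map_inv, ← hw', ← hw, inv_mul_cancel]
    have h2 := retract_insert_eq_one hv h1
    rw [hins, map_mul, map_inv, hT, retract_retract_of_subset Set.sdiff_subset] at h2
    exact (inv_mul_eq_one.1 h2).symm
  exact ih _ hcard T' S g hg hS rfl

/-! ### Joins -/

theorem retract_insert_of_adj {v : V} {T : Set V} (hv : v ∉ T) (h : ∀ t ∈ T, Γ.Adj v t)
    (g : GraphProduct Γ G) :
    retract Γ G (insert v T) g = retract Γ G {v} g * retract Γ G T g := by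
  have hc : ∀ x y, Commute (retract Γ G {v} x) (retract Γ G T y) :=
    commute_retract fun s hs t ht => by rw [Set.mem_singleton_iff.1 hs]; exact h t ht
  refine DFunLike.congr_fun (hom_ext (f' := MonoidHom.mk'
    (fun g => retract Γ G {v} g * retract Γ G T g) fun x y => ?_) fun s a => ?_) g
  · rw [map_mul, map_mul, mul_assoc, mul_assoc, ← mul_assoc (retract Γ G {v} y), (hc y x).eq,
      mul_assoc]
  · rw [MonoidHom.mk'_apply]
    by_cases hs : s = v
    · subst hs
      rw [retract_of_mem (Set.mem_insert s T), retract_of_mem (Set.mem_singleton s),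
        retract_of_notMem hv, mul_one]
    · rw [retract_of_notMem (S := {v}) hs, one_mul]
      by_cases ht : s ∈ T
      · rw [retract_of_mem ht, retract_of_mem (Set.mem_insert_of_mem v ht)]
      · rw [retract_of_notMem ht, retract_of_notMem]
        simp [hs, ht]

end GraphProduct

/-! ### Permanence properties of the classes -/

section Permanence

open DihedralGroup

theorem IsCardGenerated.of_surjective {I : Set Cardinal.{w}} {H K : Type w} [Group H] [Group K]
    (hH : IsCardGenerated I H) (f : H →* K) (hf : Function.Surjective f) :
    IsCardGenerated I K := by
  obtain ⟨X, hX, κ, hκ, hle⟩ := hH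
  refine ⟨f '' X, ?_, κ, hκ, Cardinal.mk_image_le.trans hle⟩
  rw [← MonoidHom.map_closure, hX, Subgroup.map_top_of_surjective f hf]

/-- A copy of `F₂` in a quotient lifts, because `F₂` is free. -/
theorem ContainsFreeGroupTwo.of_surjective {H K : Type w} [Group H] [Group K] (f : H →* K)
    (hf : Function.Surjective f) (hK : ContainsFreeGroupTwo K) : ContainsFreeGroupTwo H := by
  obtain ⟨g, hg⟩ := hK
  choose r hr using hf
  refine ⟨FreeGroup.lift fun i => r (g (FreeGroup.of i)), ?_⟩
  have : f.comp (FreeGroup.lift fun i => r (g (FreeGroup.of i))) = g := by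
    ext i
    simp [hr]
  rw [← this, MonoidHom.coe_comp] at hg
  exact hg.of_comp

namespace ISG

variable {I : Set Cardinal.{w}} {V : Type u} {G : V → Type v} [∀ s, Group (G s)]

theorem one_le {n : ℕ} {H : Type w} [Group H] (h : ISG I G n H) : 1 ≤ n := by
  induction h <;> omega

theorem punit (s : V) {H : Type w} [Group H] (hH : IsCardGenerated I H) {n : ℕ} (hn : 1 ≤ n) :
    ISG I G n PUnit.{w + 1} := by
  have hgen : IsCardGenerated I PUnit.{w + 1} :=
    hH.of_surjective 1 fun x => ⟨1, Subsingleton.elim _ _⟩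
  have h1 : ISG I G 1 PUnit.{w + 1} := by
    refine vertex hgen ?_ s 1 fun x y _ => Subsingleton.elim _ _
    rintro ⟨f, hf⟩
    exact FreeGroup.of_ne_one (0 : Fin 2) (hf (Subsingleton.elim _ _))
  induction n, hn using Nat.le_induction with
  | base => exact h1
  | succ n hn ih => exact prod hn le_rfl rfl ih h1 hgen 1 fun x y _ => Subsingleton.elim _ _

/-- The classes increase with their number, for `I`-generated groups: `H` embeds in `H × 1`. -/
theorem mono (s : V) {m n : ℕ} (hmn : m ≤ n) {H : Type w} [Group H]
    (hgen : IsCardGenerated I H) (h : ISG I G m H) : ISG I G n H := by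
  rcases hmn.eq_or_lt with rfl | hlt
  · exact h
  · exact prod h.one_le (show 1 ≤ n - m by omega) (by omega) h
      (punit s hgen (by omega)) hgen ((MonoidHom.id H).prod 1)
      fun x y e => congrArg Prod.fst e

theorem two_of_dihedral {K : Type w} [Group K] (τ : K →* DihedralGroup 0)
    (hτ : Function.Injective τ) (hr : ∃ h i, i ≠ 0 ∧ τ h = rot i)
    (hs : (∃ h i, τ h = mirror i) → ∃ (s : V) (g : G s), orderOf g = 2) : ISG I G 2 K := by
  rcases mulEquiv_of_injective_dihedral τ hτ hr with ⟨⟨e⟩⟩ | ⟨⟨e⟩, hm⟩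
  · exact int e
  · obtain ⟨s, g, hg⟩ := hs hm
    exact dihedral s g hg e

end ISG

end Permanence

/-! ### Subgroups without free subgroups of rank two -/

namespace GraphProduct

open DihedralGroup

/-- An `I`-generated group without a copy of `F₂` that embeds in the parabolic subgroup of a nonempty
set `T` of vertices belongs to the class with number `|T|`. -/
theorem isg_of_parabolic {V : Type u} [Finite V] (Γ : SimpleGraph V) (G : V → Type v)
    [∀ s, Group (G s)] (I : Set Cardinal.{max u v}) (T : Set V) (hT : T.Nonempty)
    {H : Type max u v} [Group H] (hgen : IsCardGenerated I H) (hfree : ¬ ContainsFreeGroupTwo H)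
    (j : H →* GraphProduct Γ G) (hj : Function.Injective j)
    (hjT : ∀ h, retract Γ G T (j h) = j h) : ISG I G T.ncard H := by
  induction hn : T.ncard using Nat.strong_induction_on generalizing T H with
  | _ n ih =>
  have hone : ∀ h, retract Γ G T (j h) = 1 → h = 1 := fun h hh => by
    rw [hjT] at hh
    exact (map_eq_one_iff j hj).1 hh
  -- The induction hypothesis applies to the images of `H` in smaller parabolic subgroups.
  have image : ∀ S : Set V, S.Nonempty → S.ncard < n →
      ISG I G S.ncard ((retract Γ G S).comp j).range := fun S hS hlt =>
    ih _ hlt S hS (hgen.of_surjective _ (MonoidHom.rangeRestrict_surjective _))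
      (fun h => hfree (h.of_surjective _ (MonoidHom.rangeRestrict_surjective _)))
      (Subgroup.subtype _) (Subgroup.subtype_injective _)
      (by rintro ⟨_, h, rfl⟩; exact retract_retract_of_subset le_rfl _) rfl
  obtain ⟨v, hvT⟩ := hT
  set T' := T \ {v} with hT'
  have hv : v ∉ T' := fun h => h.2 rfl
  have hins : insert v T' = T := Set.insert_sdiff_self_of_mem hvT
  have hcard : T'.ncard + 1 = n := hn ▸ Set.ncard_sdiff_singleton_add_one hvT
  rcases T'.eq_empty_or_nonempty with hemp | hne
  · rw [hemp, Set.ncard_empty, zero_add] at hcard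
    subst hcard
    refine ISG.vertex hgen hfree v ((proj Γ G v).comp j) ?_
    rw [injective_iff_map_eq_one]
    intro h hh
    apply hone
    rw [← hins, hemp, insert_empty_eq, ← of_proj]
    exact (congrArg _ hh).trans (map_one _)
  have hpos : 1 ≤ T'.ncard := (Set.ncard_pos).2 hne
  -- The case in which `H` embeds in the product of its images.
  have split : (∀ h, retract Γ G {v} (j h) = 1 → retract Γ G T' (j h) = 1 → h = 1) →
      ISG I G n H := fun hinj => by
    have h1 := image {v} (Set.singleton_nonempty v) (by rw [Set.ncard_singleton]; omega)
    rw [Set.ncard_singleton] at h1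
    refine ISG.prod le_rfl hpos (by omega) h1 (image T' hne (by omega)) hgen
      (((retract Γ G {v}).comp j).rangeRestrict.prod ((retract Γ G T').comp j).rangeRestrict) ?_
    rw [injective_iff_map_eq_one]
    intro h hh
    exact hinj h (congrArg Subtype.val (congrArg Prod.fst hh))
      (congrArg Subtype.val (congrArg Prod.snd hh))
  by_cases hcone : ∀ t ∈ T', Γ.Adj v t
  · refine split fun h h1 h2 => hone h ?_
    rw [← hins, retract_insert_of_adj hv hcone, h1, h2, mul_one]
  set L := link Γ v T'
  have hL : L.ncard < T'.ncard := by
    push Not at hcone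
    obtain ⟨t, ht, hadj⟩ := hcone
    exact Set.ncard_lt_ncard ⟨fun s hs => hs.1, fun h => hadj (h ht).2⟩ (Set.toFinite _)
  have hright : ∀ h, (((toFreePerm Γ G v T').comp j) h).right =
      (proj Γ G v (j h), (retract Γ G T').rangeRestrict (j h)) := fun h => toFreePerm_right hv _
  have hΦ : Function.Injective ((toFreePerm Γ G v T').comp j) := by
    rw [injective_iff_map_eq_one]
    intro h hh
    apply hone
    rw [← hins]
    exact retract_insert_eq_one hv hh
  have hright_one : ∀ h, proj Γ G v (j h) = 1 → retract Γ G T' (j h) = 1 →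
      (((toFreePerm Γ G v T').comp j) h).right = 1 := fun h h1 h2 => by
    rw [hright, h1]
    exact Prod.ext rfl (Subtype.ext h2)
  rcases FreePerm.injective_or_exists_hom_dihedral _ hΦ hfree with hinj | ⟨τ, e, hr, hker, hmir⟩
  · refine split fun h h1 h2 => hinj h (hright_one h ?_ h2)
    rw [← of_proj] at h1
    rw [← proj_of_self v (proj Γ G v (j h)) (Γ := Γ), h1, map_one]
  -- The stabilizer of a letter is conjugate to the parabolic subgroup of the link.
  have hLker : ∀ h, τ h = 1 → retract Γ G L (j h) = 1 → h = 1 := fun h h1 h2 => by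
    obtain ⟨hfix, hrt⟩ := hker h h1
    rw [hright] at hfix
    obtain ⟨a, x, rfl⟩ : ∃ a x, e = Letters.mk a x := ⟨e.1, e.2, rfl⟩
    obtain ⟨x, rfl⟩ := QuotientGroup.mk_surjective x
    set q := (retract Γ G T').rangeRestrict (j h) with hq
    have h3 : proj Γ G v (j h) * a = a := congrArg Prod.fst hfix
    have h4 : ((q * x : parabolic Γ G T') : Cosets Γ G v T') = (x : Cosets Γ G v T') :=
      congrArg Prod.snd hfix
    refine hrt (hright_one h (mul_eq_right.1 h3) ?_)
    have h5 := mem_linkSubgroup.1 (QuotientGroup.eq.1 h4.symm)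
    rw [Subgroup.coe_mul, Subgroup.coe_mul, Subgroup.coe_inv, map_mul, map_mul, map_inv, hq,
      MonoidHom.coe_rangeRestrict,
      retract_retract_of_superset (show L ⊆ T' from fun s hs => hs.1), h2, one_mul,
      inv_mul_cancel, eq_comm, ← mul_assoc] at h5
    exact conj_eq_one_iff.1 (by rw [inv_inv]; exact h5)
  have htwo : (∃ h i, τ h = mirror i) → ∃ (s : V) (g : G s), orderOf g = 2 := by
    rintro ⟨h, i, hi⟩
    by_contra hno
    push Not at hno
    have htor : ∀ s (a : G s), a * a = 1 → a = 1 := fun s a ha => by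
      by_contra hne
      exact hno s a (orderOf_eq_prime (by rw [pow_two, ha]) hne)
    obtain ⟨e', h1, h2⟩ := hmir h i hi
    exact h1 (smul_letter_eq (htor v)
      (fun S g => retract_eq_of_mul_self htor T' S g) _ _ h2)
  -- There is no class with number `0`, so an empty link is treated separately.
  rcases L.eq_empty_or_nonempty with hemp | hLne
  · refine ISG.mono v (show 2 ≤ n by omega) hgen (ISG.two_of_dihedral τ ?_ hr htwo)
    rw [injective_iff_map_eq_one]
    exact fun h hh => hLker h hh (by rw [hemp, retract_empty])
  · have hquot : ISG I G 2 (H ⧸ τ.ker) := by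
      refine ISG.two_of_dihedral (QuotientGroup.kerLift τ) (QuotientGroup.kerLift_injective τ) ?_ ?_
      · obtain ⟨h, i, hi, hh⟩ := hr
        exact ⟨h, i, hi, hh⟩
      · rintro ⟨h, i, hi⟩
        obtain ⟨h, rfl⟩ := QuotientGroup.mk_surjective h
        exact htwo ⟨h, i, hi⟩
    refine ISG.mono v (show 2 + L.ncard ≤ n by omega) hgen (ISG.prod (by omega)
      ((Set.ncard_pos).2 hLne) rfl hquot (image L hLne (by omega)) hgen
      ((QuotientGroup.mk' τ.ker).prod ((retract Γ G L).comp j).rangeRestrict) ?_)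
    rw [injective_iff_map_eq_one]
    intro h hh
    exact hLker h ((QuotientGroup.eq_one_iff h).1 (congrArg Prod.fst hh))
      (congrArg Subtype.val (congrArg Prod.snd hh))

end GraphProduct

theorem theorem4p3 {V : Type u} [Finite V] [Nonempty V] (Γ : SimpleGraph V)
    (G : V → Type v) [∀ s, Group (G s)] (I : Set Cardinal.{max u v})
    (H : Subgroup (GraphProduct Γ G)) (hgen : IsCardGenerated I H)
    (hfree : ¬ ContainsFreeGroupTwo H) :
    ISG I G (Nat.card V) H := by
  rw [← Set.ncard_univ]
  exact GraphProduct.isg_of_parabolic Γ G I Set.univ Set.univ_nonempty hgen hfree H.subtype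
    H.subtype_injective fun h => GraphProduct.retract_univ _
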